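/- Let $G$ be a compact Lie group and let $H\subset G$ be a compact Lie subgroup, with Lie algebras $\mathfrak h\subset\mathfrak g$. Let $Q$ be a bi-invariant (i.e. $\mathrm{Ad}(G)$-invariant) inner product on $\mathfrak g$, and let $\mathfrak h^{\perp}$ be the $Q$-orthogonal complement of $\mathfrak h$ in $\mathfrak g$. For $t>0$ let $g_t$ be the left-invariant Riemannian metric on $G$ induced by the inner product $$Q_t := t\,Q|_{\mathfrak h}+Q|_{\mathfrak h^{\perp}},\qquad\text{i.e.}\qquad Q_t(x,y)=t\,Q(x_{\mathfrak h},y_{\mathfrak h})+Q(x_{\mathfrak h^\perp},y_{\mathfrak h^\perp}),$$ where $x=x_{\mathfrak h}+x_{\mathfrak h^\perp}$ is the decomposition according to $\mathfrak g=\mathfrak h\oplus\mathfrak h^\perp$. If there is a $t>1$ such that $g_t$ has non-negative sectional curvature, then the semisimple part of $\mathfrak h$ (the sum of all simple ideals of $\mathfrak h$) is an ideal of $\mathfrak g$. -/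

import Mathlib

open scoped Manifold ContDiff Bundle

/-! ### Riemannian geometry -/

section Riemannian

variable {E : Type*} [NormedAddCommGroup E] [NormedSpace ℝ E]
  {M : Type*} [TopologicalSpace M] [ChartedSpace E M]

/-- A smooth (`C^∞`) vector field on `M`. -/
def IsSmoothVectorField [IsManifold 𝓘(ℝ, E) 1 M] (X : Π p : M, TangentSpace 𝓘(ℝ, E) p) : Prop :=
  ContMDiff 𝓘(ℝ, E) 𝓘(ℝ, E).tangent ∞ (fun p ↦ (⟨p, X p⟩ : TangentBundle 𝓘(ℝ, E) M))

/-- A smooth Riemannian metric on the manifold `M` (without boundary, modelled on `E`). -/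
abbrev SmoothMetric (E : Type*) [NormedAddCommGroup E] [NormedSpace ℝ E]
    (M : Type*) [TopologicalSpace M] [ChartedSpace E M] [IsManifold 𝓘(ℝ, E) 1 M] :=
  Bundle.ContMDiffRiemannianMetric 𝓘(ℝ, E) ∞ E (fun p : M ↦ TangentSpace 𝓘(ℝ, E) p)

/-- An affine connection on `M`. -/
abbrev AffineConnection (E : Type*) [NormedAddCommGroup E] [NormedSpace ℝ E]
    (M : Type*) [TopologicalSpace M] [ChartedSpace E M] [IsManifold 𝓘(ℝ, E) 1 M] :=
  CovariantDerivative 𝓘(ℝ, E) E (fun p : M ↦ TangentSpace 𝓘(ℝ, E) p)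

/-- The vector field `∇_X Y`. -/
noncomputable def AffineConnection.along [IsManifold 𝓘(ℝ, E) 1 M] (nabla : AffineConnection E M)
    (X Y : Π p : M, TangentSpace 𝓘(ℝ, E) p) : Π p : M, TangentSpace 𝓘(ℝ, E) p :=
  fun p ↦ nabla Y p (X p)

/-- The curvature `R(X, Y) Z = ∇_X ∇_Y Z - ∇_Y ∇_X Z - ∇_[X, Y] Z`. -/
noncomputable def AffineConnection.curvature [IsManifold 𝓘(ℝ, E) 1 M] (nabla : AffineConnection E M)
    (X Y Z : Π p : M, TangentSpace 𝓘(ℝ, E) p) : Π p : M, TangentSpace 𝓘(ℝ, E) p :=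
  nabla.along X (nabla.along Y Z) - nabla.along Y (nabla.along X Z)
    - nabla.along (VectorField.mlieBracket 𝓘(ℝ, E) X Y) Z

/-- `nabla` is the Levi-Civita connection of `g`: it is torsion-free, `∇_X Y - ∇_Y X = [X, Y]`, and
compatible with the metric, `X g(Y, Z) = g(∇_X Y, Z) + g(Y, ∇_X Z)`. -/
structure IsLeviCivita [IsManifold 𝓘(ℝ, E) 1 M]
    (g : SmoothMetric E M) (nabla : AffineConnection E M) : Prop where
  torsion_free : ∀ X Y : Π p : M, TangentSpace 𝓘(ℝ, E) p,
    IsSmoothVectorField X → IsSmoothVectorField Y →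
      nabla.along X Y - nabla.along Y X = VectorField.mlieBracket 𝓘(ℝ, E) X Y
  metric_compatible : ∀ X Y Z : Π p : M, TangentSpace 𝓘(ℝ, E) p,
    IsSmoothVectorField X → IsSmoothVectorField Y → IsSmoothVectorField Z → ∀ p : M,
      mvfderiv 𝓘(ℝ, E) (fun q : M ↦ g.inner q (Y q) (Z q)) p (X p) =
        g.inner p (nabla.along X Y p) (Z p) + g.inner p (Y p) (nabla.along X Z p)

/-- The sectional curvature at `p`, with respect to the connection `nabla`, of the plane spanned by
the values at `p` of the vector fields `X` and `Y`. -/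
noncomputable def sectionalCurvature [IsManifold 𝓘(ℝ, E) 1 M]
    (g : SmoothMetric E M) (nabla : AffineConnection E M)
    (X Y : Π p : M, TangentSpace 𝓘(ℝ, E) p) (p : M) : ℝ :=
  g.inner p (nabla.curvature X Y Y p) (X p) /
    (g.inner p (X p) (X p) * g.inner p (Y p) (Y p) - g.inner p (X p) (Y p) ^ 2)

/-- The Riemannian manifold `(M, g)` has non-negative sectional curvature. -/
def HasNonnegSectionalCurvature [IsManifold 𝓘(ℝ, E) 1 M]
    (g : SmoothMetric E M) : Prop :=
  ∃ nabla : AffineConnection E M, IsLeviCivita g nabla ∧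
    ∀ X Y : Π p : M, TangentSpace 𝓘(ℝ, E) p, IsSmoothVectorField X → IsSmoothVectorField Y →
      ∀ p : M, LinearIndependent ℝ ![X p, Y p] → 0 ≤ sectionalCurvature g nabla X Y p

end Riemannian

/-! ### Linear algebra -/

section LinearAlgebra

/-- An inner product on a real vector space: a symmetric, positive definite bilinear form. -/
structure IsInnerProduct {V : Type*} [AddCommGroup V] [Module ℝ V]
    (Q : LinearMap.BilinForm ℝ V) : Prop where
  symm : ∀ x y, Q x y = Q y x
  pos : ∀ x, x ≠ 0 → 0 < Q x x

variable {V : Type*} [AddCommGroup V] [Module ℝ V] [FiniteDimensional ℝ V]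

theorem IsInnerProduct.isCompl {Q : LinearMap.BilinForm ℝ V} (hQ : IsInnerProduct Q)
    (W : Submodule ℝ V) : IsCompl W (Q.orthogonal W) := by
  have hr : Q.IsRefl := fun x y h ↦ by rw [hQ.symm, h]
  rw [LinearMap.BilinForm.isCompl_orthogonal_iff_disjoint hr, Submodule.disjoint_def]
  intro x hx hx'
  by_contra h
  exact (hQ.pos x h).ne' (hx' x hx)

/-- The orthogonal projection onto `W` with respect to the inner product `Q`. -/
noncomputable def orthProj (Q : LinearMap.BilinForm ℝ V) (hQ : IsInnerProduct Q)
    (W : Submodule ℝ V) : V →ₗ[ℝ] V :=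
  W.projection (Q.orthogonal W) (hQ.isCompl W)

/-- The bilinear form `t Q|_W + Q|_{W^⊥}`, i.e. `t Q(x_W, y_W) + Q(x_{W^⊥}, y_{W^⊥})`. -/
noncomputable def stretch (Q : LinearMap.BilinForm ℝ V) (hQ : IsInnerProduct Q)
    (W : Submodule ℝ V) (t : ℝ) : LinearMap.BilinForm ℝ V :=
  t • Q.compl₁₂ (orthProj Q hQ W) (orthProj Q hQ W)
    + Q.compl₁₂ ((LinearMap.id : V →ₗ[ℝ] V) - orthProj Q hQ W)
      ((LinearMap.id : V →ₗ[ℝ] V) - orthProj Q hQ W)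

theorem isInnerProduct_stretch {Q : LinearMap.BilinForm ℝ V} (hQ : IsInnerProduct Q)
    (W : Submodule ℝ V) {t : ℝ} (ht : 0 < t) : IsInnerProduct (stretch Q hQ W t) where
  symm x y := by
    simp only [stretch, LinearMap.add_apply, LinearMap.smul_apply, LinearMap.compl₁₂_apply]
    rw [hQ.symm (orthProj Q hQ W x), hQ.symm (((LinearMap.id : V →ₗ[ℝ] V) - orthProj Q hQ W) x) (((LinearMap.id : V →ₗ[ℝ] V) - orthProj Q hQ W) y)]
  pos x hx := by
    have nn : ∀ z, 0 ≤ Q z z := fun z ↦ by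
      rcases eq_or_ne z 0 with rfl | h
      · simp
      · exact (hQ.pos z h).le
    simp only [stretch, LinearMap.add_apply, LinearMap.smul_apply, LinearMap.compl₁₂_apply,
      smul_eq_mul]
    rcases eq_or_ne (orthProj Q hQ W x) 0 with h | h
    · simpa [h] using hQ.pos x hx
    · have h1 := mul_pos ht (hQ.pos _ h)
      have h2 := nn (((LinearMap.id : V →ₗ[ℝ] V) - orthProj Q hQ W) x)
      linarith

end LinearAlgebra

/-- The semisimple part of a compact Lie algebra, i.e. the sum of its simple ideals. -/
def semisimplePart (L : Type*) [LieRing L] [LieAlgebra ℝ L] : LieIdeal ℝ L :=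
  sSup {S : LieIdeal ℝ L | LieAlgebra.IsSimple ℝ S}

/-! ### Lie groups -/

instance instLEInftyMinSmoothness : ENat.LEInfty (minSmoothness ℝ 3) := ⟨by
  rw [minSmoothness_of_isRCLikeNormedField]; exact ENat.LEInfty.out⟩

section LieGroup

variable {E : Type*} [NormedAddCommGroup E] [NormedSpace ℝ E]
  {G : Type*} [TopologicalSpace G] [ChartedSpace E G] [Group G]

/-- The adjoint representation: `Ad a` is the derivative at `1` of `b ↦ a b a⁻¹`. -/
noncomputable def Ad (a : G) :
    GroupLieAlgebra 𝓘(ℝ, E) G →L[ℝ] GroupLieAlgebra 𝓘(ℝ, E) G :=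
  mfderiv 𝓘(ℝ, E) 𝓘(ℝ, E) (fun b : G ↦ a * b * a⁻¹) 1

/-- An inner product on the Lie algebra of `G` is bi-invariant if it is invariant under `Ad`. -/
def IsBiinvariant (Q : LinearMap.BilinForm ℝ (GroupLieAlgebra 𝓘(ℝ, E) G)) : Prop :=
  ∀ (a : G) (x y : GroupLieAlgebra 𝓘(ℝ, E) G), Q (Ad a x) (Ad a y) = Q x y

/-- The derivative at `a` of the left translation by `a⁻¹`, as a map from `T_a G` to `T_1 G`. -/
noncomputable def translateToOne (a : G) :
    TangentSpace 𝓘(ℝ, E) a →L[ℝ] GroupLieAlgebra 𝓘(ℝ, E) G :=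
  mfderiv 𝓘(ℝ, E) 𝓘(ℝ, E) (fun b : G ↦ a⁻¹ * b) a

theorem isVonNBounded_of_pos {V : Type*} [NormedAddCommGroup V] [NormedSpace ℝ V]
    [FiniteDimensional ℝ V] (B : V →L[ℝ] V →L[ℝ] ℝ) (h : ∀ x, x ≠ 0 → 0 < B x x) :
    Bornology.IsVonNBounded ℝ {v : V | B v v < 1} := by
  rcases subsingleton_or_nontrivial V with hV | hV
  · exact (NormedSpace.isVonNBounded_iff ℝ).2 (Set.toFinite _).isBounded
  have hc : Continuous fun v : V ↦ B v v := by fun_prop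
  obtain ⟨z, hz, hmin⟩ := (isCompact_sphere (0 : V) 1).exists_isMinOn
    (NormedSpace.sphere_nonempty.2 zero_le_one) hc.continuousOn
  have hz0 : z ≠ 0 := by rintro rfl; simp at hz
  have hc0 := h z hz0
  rw [NormedSpace.isVonNBounded_iff, Metric.isBounded_iff_subset_closedBall 0]
  refine ⟨1 + (B z z)⁻¹, fun v hv ↦ ?_⟩
  rw [mem_closedBall_zero_iff]
  rcases eq_or_ne v 0 with rfl | hv0
  · simp; positivity
  have hn : 0 < ‖v‖ := norm_pos_iff.2 hv0
  have h1 : B z z ≤ B (‖v‖⁻¹ • v) (‖v‖⁻¹ • v) := hmin (by simp [norm_smul, hn.ne'])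
  have h2 : B z z * ‖v‖ ^ 2 ≤ B v v := by
    have h3 : B (‖v‖⁻¹ • v) (‖v‖⁻¹ • v) = B v v / ‖v‖ ^ 2 := by
      simp only [map_smul, smul_apply, smul_eq_mul]
      field_simp
    rw [h3, le_div_iff₀ (by positivity)] at h1
    exact h1
  have h4 : B v v < 1 := hv
  have h5 : ‖v‖ ^ 2 < (B z z)⁻¹ := by
    rw [lt_inv_comm₀ (by positivity) hc0, inv_eq_one_div, lt_div_iff₀ (by positivity)]
    linarith
  nlinarith [sq_nonneg (‖v‖ - 1)]

instance instFiniteDimensionalTangentSpace [FiniteDimensional ℝ E] (a : G) :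
    FiniteDimensional ℝ (TangentSpace 𝓘(ℝ, E) a) :=
  inferInstanceAs (FiniteDimensional ℝ E)

instance instT2SpaceTangentSpace (a : G) : T2Space (TangentSpace 𝓘(ℝ, E) a) :=
  inferInstanceAs (T2Space E)

variable [LieGroup 𝓘(ℝ, E) ∞ G]

theorem translateToOne_injective (a : G) : Function.Injective (translateToOne (E := E) a) := by
  have hL : ∀ c : G, MDifferentiable 𝓘(ℝ, E) 𝓘(ℝ, E) (fun b : G ↦ c * b) := fun c ↦
    (contMDiff_mul_left (I := 𝓘(ℝ, E)) (n := ∞) (a := c)).mdifferentiable (by simp)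
  have h := mfderiv_comp (I := 𝓘(ℝ, E)) (I' := 𝓘(ℝ, E)) (I'' := 𝓘(ℝ, E)) a
    (hL a (a⁻¹ * a)) (hL a⁻¹ a)
  have hid : (fun b : G ↦ a * b) ∘ (fun b ↦ a⁻¹ * b) = id := by ext b; simp
  rw [hid, mfderiv_id] at h
  intro v w hvw
  have hv := congrArg (fun f ↦ f v) h
  have hw := congrArg (fun f ↦ f w) h
  refine hv.trans (Eq.trans ?_ hw.symm)
  exact congrArg (mfderiv 𝓘(ℝ, E) 𝓘(ℝ, E) (fun b : G ↦ a * b) (a⁻¹ * a)) hvw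

theorem contDiff_bilinearComp (B : E →L[ℝ] E →L[ℝ] ℝ) :
    ContDiff ℝ ∞ (fun φ : E →L[ℝ] E ↦ B.bilinearComp φ φ) := by
  have h : (fun φ : E →L[ℝ] E ↦ B.bilinearComp φ φ) =
      fun φ ↦ ContinuousLinearMap.flipₗᵢ ℝ E E ℝ
        ((ContinuousLinearMap.flipₗᵢ ℝ E E ℝ (B.comp φ)).comp φ) := rfl
  rw [h]
  refine (LinearIsometryEquiv.contDiff _).comp (ContDiff.clm_comp ?_ contDiff_id)
  exact (LinearIsometryEquiv.contDiff _).comp (contDiff_const.clm_comp contDiff_id)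

theorem contMDiff_leftInvariant (B : E →L[ℝ] E →L[ℝ] ℝ)
    (g : Π a : G, TangentSpace 𝓘(ℝ, E) a →L[ℝ] TangentSpace 𝓘(ℝ, E) a →L[ℝ] ℝ)
    (hg : ∀ a u v, g a u v = B (translateToOne (E := E) a u) (translateToOne (E := E) a v)) :
    ContMDiff 𝓘(ℝ, E) (𝓘(ℝ, E).prod 𝓘(ℝ, E →L[ℝ] E →L[ℝ] ℝ)) ∞
      (fun a : G ↦ Bundle.TotalSpace.mk' (E →L[ℝ] E →L[ℝ] ℝ)
        (E := fun a : G ↦ TangentSpace 𝓘(ℝ, E) a →L[ℝ] TangentSpace 𝓘(ℝ, E) a →L[ℝ] ℝ) a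
        (g a)) := by
  intro a₀
  rw [contMDiffAt_hom_bundle]
  refine ⟨contMDiffAt_id, ?_⟩
  have hmul : ContMDiffAt (𝓘(ℝ, E).prod 𝓘(ℝ, E)) 𝓘(ℝ, E) ∞
      (Function.uncurry fun a b : G ↦ a⁻¹ * b) (a₀, id a₀) :=
    ((contMDiff_fst.inv).mul contMDiff_snd).contMDiffAt
  have hD := ContMDiffAt.mfderiv (m := ∞) (fun a b : G ↦ a⁻¹ * b) id hmul contMDiffAt_id
    (by simp)
  have hB := ((contDiff_bilinearComp B).contMDiff).contMDiffAt.comp a₀ hD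
  refine hB.congr_of_eventuallyEq ?_
  have hmem : (chartAt E a₀).source ∈ nhds a₀ := (chartAt E a₀).open_source.mem_nhds
    (mem_chart_source E a₀)
  filter_upwards [hmem] with a ha
  ext u v
  have h1 : a⁻¹ * a ∈ (chartAt E (a₀⁻¹ * a₀)).source := by
    rw [inv_mul_cancel, inv_mul_cancel]; exact mem_chart_source E 1
  have key : ∀ w : E, inTangentCoordinates 𝓘(ℝ, E) 𝓘(ℝ, E) id (fun a : G ↦ a⁻¹ * a)
      (fun a ↦ mfderiv 𝓘(ℝ, E) 𝓘(ℝ, E) (fun b : G ↦ a⁻¹ * b) a) a₀ a w =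
      translateToOne (E := E) a
        ((trivializationAt E (TangentSpace 𝓘(ℝ, E)) a₀).symm a w) := by
    intro w
    have h2 : ∀ z : E, (tangentBundleCore 𝓘(ℝ, E) G).coordChange (achart E (a⁻¹ * a))
        (achart E (a₀⁻¹ * a₀)) (a⁻¹ * a) z = z := by
      intro z
      have h3 : a₀⁻¹ * a₀ = a⁻¹ * a := by rw [inv_mul_cancel, inv_mul_cancel]
      rw [h3]
      exact (tangentBundleCore 𝓘(ℝ, E) G).coordChange_self _ _ (mem_chart_source E _) z
    have h6 := inTangentCoordinates_eq (I := 𝓘(ℝ, E)) (I' := 𝓘(ℝ, E)) id (fun a : G ↦ a⁻¹ * a)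
      (fun a : G ↦ mfderiv 𝓘(ℝ, E) 𝓘(ℝ, E) (fun b : G ↦ a⁻¹ * b) a) ha h1
    refine (congrArg (fun f : E →L[ℝ] E ↦ f w) h6).trans ((h2 _).trans ?_)
    have h4 := TangentBundle.symmL_trivializationAt_eq_core (I := 𝓘(ℝ, E)) ha
    have h5 := Bundle.Trivialization.symmL_apply (R := ℝ)
      (trivializationAt E (TangentSpace 𝓘(ℝ, E)) a₀) (b := a) ha w
    rw [← h5, h4]
    rfl
  refine (inCoordinates_apply_eq₂ (F₁ := E) (F₂ := E) (F₃ := ℝ) (E₁ := TangentSpace 𝓘(ℝ, E))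
    (E₂ := TangentSpace 𝓘(ℝ, E)) (E₃ := Bundle.Trivial G ℝ) (x₀ := a₀) (x := a) (ϕ := g a)
    (v := u) (w := v) ha ha (Set.mem_univ _)).trans ?_
  have hL : ∀ r : ℝ, Bundle.Trivialization.linearMapAt ℝ
      (trivializationAt ℝ (Bundle.Trivial G ℝ) a₀) a r = r := fun r ↦ by simp
  refine (hL _).trans ((hg a _ _).trans ?_)
  rw [← key, ← key]
  rfl

/-- The left-invariant Riemannian metric on `G` induced by the inner product `B` on its Lie algebra:
`g_a(u, v) = B((dL_{a⁻¹})_a u, (dL_{a⁻¹})_a v)`. -/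
noncomputable def leftInvariantMetric [FiniteDimensional ℝ E]
    (B : LinearMap.BilinForm ℝ (GroupLieAlgebra 𝓘(ℝ, E) G)) (hB : IsInnerProduct B) :
    SmoothMetric E G where
  inner a := (B.compl₁₂ (translateToOne (E := E) a).toLinearMap
    (translateToOne (E := E) a).toLinearMap).toContinuousBilinearMap
  symm _ _ _ := hB.symm _ _
  pos a _ hv := hB.pos _ fun h ↦ hv (translateToOne_injective a (h.trans (map_zero _).symm))
  isVonNBounded a := isVonNBounded_of_pos (V := E) (B.compl₁₂ (translateToOne (E := E) a).toLinearMap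
    (translateToOne (E := E) a).toLinearMap).toContinuousBilinearMap
      fun _ hv ↦ hB.pos _ fun h ↦ hv (translateToOne_injective a (h.trans (map_zero _).symm))
  contMDiff := contMDiff_leftInvariant
    (LinearMap.toContinuousBilinearMap (E := E) (F := E) B) _ fun _ _ _ ↦ rfl

/-- The inclusion `𝔥 → 𝔤` of Lie algebras induced by the inclusion `H → G`, i.e. its derivative. -/
noncomputable def lieAlgebraInclusion {EH : Type*} [NormedAddCommGroup EH] [NormedSpace ℝ EH]
    (H : Subgroup G) [ChartedSpace EH H] :
    GroupLieAlgebra 𝓘(ℝ, EH) H →ₗ[ℝ] GroupLieAlgebra 𝓘(ℝ, E) G :=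
  (mfderiv 𝓘(ℝ, EH) 𝓘(ℝ, E) (Subtype.val : H → G) 1).toLinearMap

/-- The left-invariant metric `g_t` on `G` induced by `Q_t = t Q|_𝔥 + Q|_{𝔥^⊥}`, where `𝔥`, the Lie
algebra of `H`, is regarded as a subspace of the Lie algebra of `G`. -/
noncomputable def stretchedMetric [FiniteDimensional ℝ E]
    {EH : Type*} [NormedAddCommGroup EH] [NormedSpace ℝ EH]
    (H : Subgroup G) [ChartedSpace EH H]
    (Q : LinearMap.BilinForm ℝ (GroupLieAlgebra 𝓘(ℝ, E) G)) (hQ : IsInnerProduct Q)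
    (t : ℝ) (ht : 0 < t) : SmoothMetric E G :=
  leftInvariantMetric (stretch Q hQ (LinearMap.range (lieAlgebraInclusion (EH := EH) H)) t)
    (isInnerProduct_stretch hQ _ ht)

end LieGroup

/-! ### Symmetric bilinear forms, Rayleigh quotients and orthogonal projections. -/

section BilinearForms

variable {V : Type*} [AddCommGroup V] [Module ℝ V]

/-! Let `P` be the `Q`-orthogonal projection of `𝔤` onto `𝔥`. Since `Q` is bi-invariant, every `ad
z` is `Q`-skew, and the Koszul formula gives the Levi-Civita product of `Q_t` in closed form. If `x`
and `y` commute, dividing their `𝔥`-components by `t` gives a pair whose curvature numerator is a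
negative multiple, as `t > 1`, of the squared `Q`-length of a bracket proportional to `⁅P x, P y⁆`.
Non-negative curvature thus forces `P` to map commuting pairs to commuting pairs
(`lie_orthProj_eq_zero_of_curvature_nonneg`). The property passes to the image `S` of each simple
ideal of `𝔥` (`lie_orthProj_eq_zero_of_ideal`).

The rest is algebra. Commuting pairs are preserved by `exp (s ad z)`, so the condition on `S` can be
differentiated, once and then again (`apply_lie_add_eq_zero_of_commute`). The first derivative shows
that an element of `S^⊥` commuting with one nonzero element of `S` commutes with all of `S`. Let `Z`
be the centralizer of `S` in `S^⊥`, and `M` the complement of `S + Z`. Nonzero elements of `S` then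
act injectively on `M`, and the second derivative gives `[Z, M] = 0`, so `L = S ⊕ M = Z^⊥` is a
subalgebra. If `M ≠ 0`, injectivity forces `S`, and then `L`, to have rank one; a non-abelian
compact algebra of rank one is three-dimensional and equals `S` (`le_of_rank_one`), contradicting `M
≠ 0`. So `M = 0` and `S` commutes with `S^⊥` (`lie_eq_zero_of_orthogonal`).

Hence the semisimple part of `𝔥` commutes with `𝔥^⊥`; being an ideal of `𝔥`, its image is an ideal
of `𝔤`. The differential geometry enters through left-invariant fields
(`curvature_nonneg_of_hasNonnegSectionalCurvature`) and through computations in the chart at `1`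
(`lieAlgebraInclusion_lie`, `IsBiinvariant.isAdInvariant`). -/

theorem IsInnerProduct.nonneg {Q : LinearMap.BilinForm ℝ V} (hQ : IsInnerProduct Q) (x : V) :
    0 ≤ Q x x := by
  rcases eq_or_ne x 0 with rfl | h
  · simp
  · exact (hQ.pos x h).le

theorem IsInnerProduct.eq_zero {Q : LinearMap.BilinForm ℝ V} (hQ : IsInnerProduct Q) {x : V}
    (h : Q x x = 0) : x = 0 := by
  by_contra hx
  exact (hQ.pos x hx).ne' h

theorem IsInnerProduct.ext {Q : LinearMap.BilinForm ℝ V} (hQ : IsInnerProduct Q) {x y : V}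
    (h : ∀ z, Q x z = Q y z) : x = y := by
  rw [← sub_eq_zero]
  exact hQ.eq_zero (by simp only [map_sub, LinearMap.sub_apply, h, sub_self])

/-- The inner product space structure data determined by a positive definite form. -/
@[reducible] noncomputable def IsInnerProduct.core {Q : LinearMap.BilinForm ℝ V}
    (hQ : IsInnerProduct Q) : InnerProductSpace.Core ℝ V where
  inner x y := Q x y
  conj_inner_symm x y := by simpa using hQ.symm y x
  re_inner_nonneg x := by simpa using hQ.nonneg x
  add_left x y z := by simp
  smul_left x y r := by simp
  definite x h := hQ.eq_zero h

/-- Along the line `v + r • u` the form is affine in `r` with slope `2 * C u v`, so it could not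
stay non-negative if the slope were nonzero. -/
theorem apply_eq_zero_of_nonneg_of_apply_self_eq_zero {C : LinearMap.BilinForm ℝ V}
    (hs : ∀ x y, C x y = C y x) (hC : ∀ x, 0 ≤ C x x) {u : V} (hu : C u u = 0) (v : V) :
    C u v = 0 := by
  by_contra h
  obtain ⟨r, hr⟩ : ∃ r : ℝ, r * C u v = -(C v v + 1) := ⟨-(C v v + 1) / C u v, by field_simp⟩
  have h1 := hC (v + r • u)
  have h2 := hC v
  simp only [map_add, map_smul, LinearMap.add_apply, LinearMap.smul_apply, smul_eq_mul, hu,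
    hs v u] at h1
  linarith

/-- Two symmetric forms, one of them positive definite, have a common eigenvector, belonging to the
minimum of the Rayleigh quotient. -/
theorem exists_rayleigh_minimizer [FiniteDimensional ℝ V] [Nontrivial V]
    {A B : LinearMap.BilinForm ℝ V} (hA : ∀ x y, A x y = A y x) (hB : IsInnerProduct B) :
    ∃ u ≠ 0, ∃ κ : ℝ, (∀ v, A u v = κ * B u v) ∧ ∀ v, κ * B v v ≤ A v v := by
  let : NormedAddCommGroup V := hB.core.toNormedAddCommGroup
  let : InnerProductSpace ℝ V := InnerProductSpace.ofCore hB.core.toCore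
  have hn : ∀ v : V, ‖v‖ ^ 2 = B v v := fun v ↦ (real_inner_self_eq_norm_sq v).symm
  have hc : Continuous fun v : V ↦ A v v :=
    (((LinearMap.toContinuousBilinearMap (E := V) (F := V) (𝕜 := ℝ)) A).continuous).clm_apply
      continuous_id
  obtain ⟨z, hz, hmin⟩ := (isCompact_sphere (0 : V) 1).exists_isMinOn
    (NormedSpace.sphere_nonempty.2 zero_le_one) hc.continuousOn
  have hz1 : ‖z‖ = 1 := by simpa using hz
  have hz0 : z ≠ 0 := by rintro rfl; simp at hz1
  have hle : ∀ v, A z z * B v v ≤ A v v := by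
    intro v
    rcases eq_or_ne v 0 with rfl | hv
    · simp
    have hv' : 0 < ‖v‖ := norm_pos_iff.2 hv
    have h1 : A z z ≤ A (‖v‖⁻¹ • v) (‖v‖⁻¹ • v) := hmin (by simp [norm_smul, hv'.ne'])
    rw [← hn]
    simp only [map_smul, LinearMap.smul_apply, smul_eq_mul] at h1
    field_simp at h1
    linarith
  refine ⟨z, hz0, A z z, fun v ↦ ?_, hle⟩
  -- The form `A - κ B` is semidefinite and vanishes at the minimizer, which therefore lies in its
  -- radical.
  have h := apply_eq_zero_of_nonneg_of_apply_self_eq_zero (C := A - A z z • B)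
    (fun x y ↦ by simp [hA x y, hB.symm x y]) (fun x ↦ by simpa using hle x) (u := z)
    (by simp [← hn, hz1]) v
  simpa [sub_eq_zero] using h

/-- Everything is required only on `W`: in `eq_smul_of_commute` the denominator `Q ⁅x, ·⁆ ⁅x, ·⁆` is
degenerate on the whole algebra. -/
theorem exists_rayleigh_minimizer_mem [FiniteDimensional ℝ V] {W : Submodule ℝ V} (hW : W ≠ ⊥)
    {A B : LinearMap.BilinForm ℝ V} (hA : ∀ x ∈ W, ∀ y ∈ W, A x y = A y x)
    (hB : ∀ x ∈ W, ∀ y ∈ W, B x y = B y x) (hB' : ∀ x ∈ W, x ≠ 0 → 0 < B x x) :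
    ∃ u ∈ W, u ≠ 0 ∧ ∃ κ : ℝ, (∀ v ∈ W, A u v = κ * B u v) ∧ ∀ v ∈ W, κ * B v v ≤ A v v := by
  have : Nontrivial W := Submodule.nontrivial_iff_ne_bot.2 hW
  obtain ⟨u, hu, κ, h1, h2⟩ := exists_rayleigh_minimizer (V := W)
    (A := A.compl₁₂ W.subtype W.subtype) (B := B.compl₁₂ W.subtype W.subtype)
    (fun x y ↦ hA x x.2 y y.2)
    ⟨fun x y ↦ hB x x.2 y y.2, fun x hx ↦ hB' x x.2 (by simpa using hx)⟩
  exact ⟨u, u.2, by simpa using hu, κ, fun v hv ↦ h1 ⟨v, hv⟩, fun v hv ↦ h2 ⟨v, hv⟩⟩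

variable [FiniteDimensional ℝ V] {Q : LinearMap.BilinForm ℝ V} (hQ : IsInnerProduct Q)
  (W : Submodule ℝ V)

theorem orthProj_mem (x : V) : orthProj Q hQ W x ∈ W :=
  Submodule.projection_apply_mem ..

theorem orthProj_of_mem {x : V} (hx : x ∈ W) : orthProj Q hQ W x = x := by
  rw [orthProj, Submodule.projection_eq_self_iff]; exact hx

theorem orthProj_of_orthogonal {x : V} (hx : ∀ w ∈ W, Q w x = 0) : orthProj Q hQ W x = 0 := by
  rw [orthProj, Submodule.projection_apply_eq_zero_iff]; exact hx

theorem apply_sub_orthProj {w : V} (hw : w ∈ W) (x : V) : Q w (x - orthProj Q hQ W x) = 0 :=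
  (Submodule.sub_projection_mem (hQ.isCompl W) x) w hw

theorem apply_orthProj {w : V} (hw : w ∈ W) (x : V) : Q w (orthProj Q hQ W x) = Q w x := by
  have := apply_sub_orthProj hQ W hw x
  rw [map_sub] at this
  linarith

theorem stretch_apply (t : ℝ) (x y : V) : stretch Q hQ W t x y =
    t * Q (orthProj Q hQ W x) (orthProj Q hQ W y)
      + Q (x - orthProj Q hQ W x) (y - orthProj Q hQ W y) := by
  simp [stretch]

end BilinearForms

/-! ### The curvature of `Q_t` on commuting pairs. -/

section StretchedCurvature

variable {V : Type*} [LieRing V] [LieAlgebra ℝ V]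

/-- The bilinear form `Q` on a Lie algebra is invariant under the adjoint representation. -/
def IsAdInvariant (Q : LinearMap.BilinForm ℝ V) : Prop :=
  ∀ x y z : V, Q ⁅x, y⁆ z = Q x ⁅y, z⁆

theorem IsAdInvariant.cyclic {Q : LinearMap.BilinForm ℝ V} (hinv : IsAdInvariant Q)
    (hQ : IsInnerProduct Q) (x y z : V) : Q ⁅x, y⁆ z = Q ⁅y, z⁆ x := by
  rw [hinv, hQ.symm]

theorem IsAdInvariant.swap {Q : LinearMap.BilinForm ℝ V} (hinv : IsAdInvariant Q)
    (x y z : V) : Q ⁅x, y⁆ z = -Q y ⁅x, z⁆ := by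
  rw [← lie_skew, map_neg, LinearMap.neg_apply, hinv]

/-- The identities satisfied by the Levi-Civita connection of a left-invariant metric, restricted to
left-invariant vector fields. -/
structure IsLeviCivitaProduct (B : LinearMap.BilinForm ℝ V) (n : V → V → V) : Prop where
  torsion_free : ∀ a b, n a b - n b a = ⁅a, b⁆
  skew : ∀ a b c, B (n a b) c + B b (n a c) = 0

/-- The cyclic sum of the skewness relations. It determines `n` from `B`, which gives both the
explicit product below and its independence of the base point in `exists_isLeviCivitaProduct`. -/
theorem IsLeviCivitaProduct.koszul {B : LinearMap.BilinForm ℝ V} {n : V → V → V}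
    (hn : IsLeviCivitaProduct B n) (hB : IsInnerProduct B) (a b c : V) :
    2 * B (n a b) c = B ⁅a, b⁆ c + B ⁅c, a⁆ b + B ⁅c, b⁆ a := by
  simp only [← hn.torsion_free, map_sub, LinearMap.sub_apply]
  linarith [hn.skew a b c, hn.skew b c a, hn.skew c a b, hB.symm b (n a c), hB.symm c (n b a),
    hB.symm a (n c b)]

theorem IsAdInvariant.lie_mem_orthogonal {Q : LinearMap.BilinForm ℝ V} (hinv : IsAdInvariant Q)
    (𝔥 : LieSubalgebra ℝ V) {a b : V} (ha : a ∈ 𝔥) (hb : ∀ w ∈ 𝔥, Q w b = 0) :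
    ∀ w ∈ 𝔥, Q w ⁅a, b⁆ = 0 := fun w hw ↦ by
  rw [← hinv]; exact hb _ (𝔥.lie_mem hw ha)

theorem IsAdInvariant.lie_mem_orthogonal' {Q : LinearMap.BilinForm ℝ V} (hinv : IsAdInvariant Q)
    (𝔥 : LieSubalgebra ℝ V) {a b : V} (ha : a ∈ 𝔥) (hb : ∀ w ∈ 𝔥, Q w b = 0) :
    ∀ w ∈ 𝔥, Q w ⁅b, a⁆ = 0 := fun w hw ↦ by
  rw [← lie_skew, map_neg, hinv.lie_mem_orthogonal 𝔥 ha hb w hw, neg_zero]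

variable [FiniteDimensional ℝ V] {Q : LinearMap.BilinForm ℝ V} (hQ : IsInnerProduct Q)
  (hinv : IsAdInvariant Q) (𝔥 : LieSubalgebra ℝ V)
include hinv

omit hinv [LieAlgebra ℝ V] in
theorem stretch_add [Module ℝ V] [FiniteDimensional ℝ V] {Q : LinearMap.BilinForm ℝ V}
    (hQ : IsInnerProduct Q) (W : Submodule ℝ V) (t : ℝ) (x : V) {c₁ c₂ : V} (h₁ : c₁ ∈ W)
    (h₂ : ∀ w ∈ W, Q w c₂ = 0) :
    stretch Q hQ W t x (c₁ + c₂) = t * Q x c₁ + Q x c₂ := by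
  rw [stretch_apply, map_add, orthProj_of_mem hQ W h₁, orthProj_of_orthogonal hQ W h₂, add_zero,
    add_sub_cancel_left, hQ.symm (orthProj Q hQ W x), apply_orthProj hQ W h₁, hQ.symm c₁, map_sub,
    LinearMap.sub_apply, h₂ _ (orthProj_mem hQ W x), sub_zero]

/-- In the Koszul formula, invariance of `Q` cycles all brackets onto the test vector. For `t = 1`
only half the bracket survives; the correction comes from the mixed brackets, as those of `𝔥` with
`𝔥^⊥` lie in `𝔥^⊥`. -/
theorem IsLeviCivitaProduct.eq_of_stretch {t : ℝ} (ht : 0 < t) {n : V → V → V}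
    (hn : IsLeviCivitaProduct (stretch Q hQ 𝔥.toSubmodule t) n) {a₁ a₂ b₁ b₂ : V}
    (ha₁ : a₁ ∈ 𝔥) (ha₂ : ∀ w ∈ 𝔥, Q w a₂ = 0) (hb₁ : b₁ ∈ 𝔥) (hb₂ : ∀ w ∈ 𝔥, Q w b₂ = 0) :
    n (a₁ + a₂) (b₁ + b₂) =
      (1 / 2 : ℝ) • (⁅a₁ + a₂, b₁ + b₂⁆ + (t - 1) • (⁅a₂, b₁⁆ + ⁅b₂, a₁⁆)) := by
  have hB := isInnerProduct_stretch hQ 𝔥.toSubmodule ht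
  refine hB.ext fun c ↦ ?_
  obtain ⟨c₁, c₂, hc₁, hc₂, rfl⟩ : ∃ c₁ c₂, c₁ ∈ 𝔥 ∧ (∀ w ∈ 𝔥, Q w c₂ = 0) ∧ c = c₁ + c₂ :=
    ⟨_, _, orthProj_mem hQ 𝔥.toSubmodule c, fun w hw ↦ apply_sub_orthProj hQ 𝔥.toSubmodule hw c,
      (add_sub_cancel _ _).symm⟩
  have hk := hn.koszul hB (a₁ + a₂) (b₁ + b₂) (c₁ + c₂)
  rw [stretch_add hQ _ t _ hc₁ hc₂, stretch_add hQ _ t _ hb₁ hb₂, stretch_add hQ _ t _ ha₁ ha₂,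
    stretch_add hQ _ t _ hc₁ hc₂] at hk
  rw [stretch_add hQ _ t _ hc₁ hc₂, stretch_add hQ _ t _ hc₁ hc₂]
  have e1 : ∀ x y z : V, Q ⁅z, x⁆ y = Q ⁅x, y⁆ z := fun x y z ↦ hinv.cyclic hQ z x y
  have z1 := hinv.lie_mem_orthogonal 𝔥 ha₁ hb₂
  have z2 := hinv.lie_mem_orthogonal 𝔥 hb₁ ha₂
  have z3 : Q ⁅a₁, b₁⁆ c₂ = 0 := hc₂ _ (𝔥.lie_mem ha₁ hb₁)
  have z4 : Q ⁅a₁, b₂⁆ c₁ = 0 := by rw [hQ.symm]; exact z1 c₁ hc₁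
  have z5 : Q ⁅b₁, a₂⁆ c₁ = 0 := by rw [hQ.symm]; exact z2 c₁ hc₁
  have w1 : ∀ x y z : V, Q ⁅x, y⁆ z = -Q ⁅y, x⁆ z := fun x y z ↦ by
    rw [← lie_skew x y, map_neg, LinearMap.neg_apply]
  simp only [add_lie, lie_add, map_add, map_smul, LinearMap.add_apply, LinearMap.smul_apply,
    smul_eq_mul, e1 _ _ c₁, e1 _ _ c₂, w1 a₂ b₁, w1 b₂ a₁, w1 b₁ a₁, w1 b₂ a₂, z3, z4, z5] at hk ⊢
  linarith

/-- Skewness turns the second-order terms into inner products of first-order ones, and Koszul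
handles the term in `⁅X, Y⁆`. The commuting relation and the Jacobi identity then make all terms in
`c` and `d` cancel, leaving only `α`. -/
theorem curvature_of_commute {t : ℝ} (ht : 0 < t) {n : V → V → V}
    (hn : IsLeviCivitaProduct (stretch Q hQ 𝔥.toSubmodule t) n) {x₁ x₂ y₁ y₂ : V}
    (hx₁ : x₁ ∈ 𝔥) (hx₂ : ∀ w ∈ 𝔥, Q w x₂ = 0) (hy₁ : y₁ ∈ 𝔥) (hy₂ : ∀ w ∈ 𝔥, Q w y₂ = 0)
    (hxy : ⁅t • x₁ + x₂, t • y₁ + y₂⁆ = 0) :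
    stretch Q hQ 𝔥.toSubmodule t (n (x₁ + x₂) (n (y₁ + y₂) (y₁ + y₂))
      - n (y₁ + y₂) (n (x₁ + x₂) (y₁ + y₂)) - n ⁅x₁ + x₂, y₁ + y₂⁆ (y₁ + y₂)) (x₁ + x₂) =
      -((t - 1) ^ 3 * t * (3 * t + 1) / 4) * Q ⁅x₁, y₁⁆ ⁅x₁, y₁⁆ := by
  have hB := isInnerProduct_stretch hQ 𝔥.toSubmodule ht
  set α := ⁅x₁, y₁⁆ with hα
  set c := ⁅x₁, y₂⁆ with hc
  set d := ⁅x₂, y₁⁆ with hd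
  set e := ⁅x₂, y₂⁆ with he
  have hα' : α ∈ 𝔥 := 𝔥.lie_mem hx₁ hy₁
  have hc' : ∀ w ∈ 𝔥, Q w c = 0 := hinv.lie_mem_orthogonal 𝔥 hx₁ hy₂
  have hd' : ∀ w ∈ 𝔥, Q w d = 0 := hinv.lie_mem_orthogonal' 𝔥 hy₁ hx₂
  have hxx : ∀ w ∈ 𝔥, Q w ⁅x₂, x₁⁆ = 0 := hinv.lie_mem_orthogonal' 𝔥 hx₁ hx₂
  have hyy : ∀ w ∈ 𝔥, Q w ⁅y₂, y₁⁆ = 0 := hinv.lie_mem_orthogonal' 𝔥 hy₁ hy₂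
  -- The commuting relation eliminates `e`, leaving only `α` in `𝔥` and `c`, `d` in `𝔥^⊥`.
  have he' : e = -(t ^ 2 • α + t • (c + d)) := by
    simp only [add_lie, lie_add, smul_lie, lie_smul, ← hα, ← hc, ← hd, ← he] at hxy
    rw [eq_neg_iff_add_eq_zero, ← hxy]
    module
  have hZ : ⁅x₁ + x₂, y₁ + y₂⁆ = ((1 - t ^ 2) • α) + ((1 - t) • (c + d)) := by
    simp only [add_lie, lie_add, ← hα, ← hc, ← hd, ← he]
    rw [he']
    module
  have nXX : n (x₁ + x₂) (x₁ + x₂) = (t - 1) • ⁅x₂, x₁⁆ := by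
    rw [hn.eq_of_stretch hQ hinv 𝔥 ht hx₁ hx₂ hx₁ hx₂, lie_self]
    module
  have nYY : n (y₁ + y₂) (y₁ + y₂) = (t - 1) • ⁅y₂, y₁⁆ := by
    rw [hn.eq_of_stretch hQ hinv 𝔥 ht hy₁ hy₂ hy₁ hy₂, lie_self]
    module
  have nXY : n (x₁ + x₂) (y₁ + y₂) = ((1 - t ^ 2) / 2) • α + (1 - t) • c := by
    rw [hn.eq_of_stretch hQ hinv 𝔥 ht hx₁ hx₂ hy₁ hy₂, hZ, ← lie_skew y₂ x₁, ← hc, ← hd]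
    module
  have nYX : n (y₁ + y₂) (x₁ + x₂) = (-(1 - t ^ 2) / 2) • α + (-(1 - t)) • d := by
    have h := hn.torsion_free (x₁ + x₂) (y₁ + y₂)
    rw [sub_eq_iff_eq_add, nXY, hZ, ← sub_eq_iff_eq_add'] at h
    rw [← h]
    module
  have k1 := hn.skew (x₁ + x₂) (n (y₁ + y₂) (y₁ + y₂)) (x₁ + x₂)
  have k2 := hn.skew (y₁ + y₂) (n (x₁ + x₂) (y₁ + y₂)) (x₁ + x₂)
  have k3 := hn.koszul hB ⁅x₁ + x₂, y₁ + y₂⁆ (y₁ + y₂) (x₁ + x₂)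
  have dd : ∀ w ∈ 𝔥, Q w (-(1 - t) • d) = 0 := fun w hw ↦ by rw [map_smul, hd' w hw, smul_zero]
  have dx : ∀ w ∈ 𝔥, Q w ((t - 1) • ⁅x₂, x₁⁆) = 0 := fun w hw ↦ by
    rw [map_smul, hxx w hw, smul_zero]
  have dz : ∀ w ∈ 𝔥, Q w ((1 - t) • (c + d)) = 0 := fun w hw ↦ by
    rw [map_smul, map_add, hc' w hw, hd' w hw, add_zero, smul_zero]
  have dm : ∀ {r : ℝ}, r • α ∈ 𝔥.toSubmodule := 𝔥.smul_mem _ hα'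
  -- The Jacobi identity for `x₁, x₂, y₁`, paired with `y₂`.
  have s6 : Q ⁅y₂, y₁⁆ ⁅x₂, x₁⁆ = -t ^ 2 * Q α α - Q d c := by
    have h1 : Q ⁅y₂, y₁⁆ ⁅x₂, x₁⁆ = Q ⁅⁅x₁, x₂⁆, y₁⁆ y₂ := by
      rw [← lie_skew y₂, ← lie_skew x₂, map_neg, map_neg, LinearMap.neg_apply, neg_neg, hQ.symm,
        ← hinv]
    rw [h1, lie_lie, map_sub, LinearMap.sub_apply, hinv.swap x₁ ⁅x₂, y₁⁆, hinv.swap x₂ ⁅x₁, y₁⁆,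
      ← hα, ← hc, ← hd, ← he, he', map_neg, map_add, map_smul, map_smul, map_add, hc' α hα',
      hd' α hα']
    simp only [smul_eq_mul]
    ring
  have s4 : stretch Q hQ 𝔥.toSubmodule t ⁅⁅x₁ + x₂, y₁ + y₂⁆, y₁ + y₂⁆ (x₁ + x₂) =
      Q ⁅x₁ + x₂, y₁ + y₂⁆ ((t * (t - 1)) • α + (t - 1) • d) := by
    have : ((t * (t - 1)) • α + (t - 1) • d) = ⁅y₁ + y₂, t • x₁ + x₂⁆ := by
      rw [← lie_skew]
      simp only [add_lie, lie_add, smul_lie, ← hα, ← hc, ← hd, ← he, he']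
      module
    rw [stretch_add hQ _ t _ hx₁ hx₂, this, ← hinv, map_add, map_smul, smul_eq_mul]
  have s5 : stretch Q hQ 𝔥.toSubmodule t ⁅x₁ + x₂, ⁅x₁ + x₂, y₁ + y₂⁆⁆ (y₁ + y₂) =
      Q ⁅x₁ + x₂, y₁ + y₂⁆ ((t * (t - 1)) • α + (t - 1) • c) := by
    have : ((t * (t - 1)) • α + (t - 1) • c) = -⁅x₁ + x₂, t • y₁ + y₂⁆ := by
      simp only [add_lie, lie_add, lie_smul, ← hα, ← hc, ← hd, ← he, he']
      module
    rw [stretch_add hQ _ t _ hy₁ hy₂, this, map_neg, ← hinv.swap, map_add, map_smul, smul_eq_mul]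
  have e1 : stretch Q hQ 𝔥.toSubmodule t (n (y₁ + y₂) (y₁ + y₂)) (n (x₁ + x₂) (x₁ + x₂)) =
      (t - 1) ^ 2 * (-t ^ 2 * Q α α - Q d c) := by
    have h := stretch_add hQ 𝔥.toSubmodule t (n (y₁ + y₂) (y₁ + y₂)) 𝔥.zero_mem dx
    rw [zero_add, ← nXX, map_zero, mul_zero, zero_add] at h
    rw [h, nXX, nYY, map_smul, map_smul, LinearMap.smul_apply, s6, smul_eq_mul, smul_eq_mul]
    ring
  have e2 : stretch Q hQ 𝔥.toSubmodule t (n (x₁ + x₂) (y₁ + y₂)) (n (y₁ + y₂) (x₁ + x₂)) =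
      -t * ((1 - t ^ 2) / 2) ^ 2 * Q α α - (1 - t) ^ 2 * Q d c := by
    rw [nYX, stretch_add hQ 𝔥.toSubmodule t _ dm dd, nXY]
    simp only [map_add, map_smul, LinearMap.add_apply, LinearMap.smul_apply, smul_eq_mul,
      hd' α hα', hQ.symm c α, hc' α hα', hQ.symm c d]
    ring
  have e3 : stretch Q hQ 𝔥.toSubmodule t ⁅x₁ + x₂, y₁ + y₂⁆ ⁅x₁ + x₂, y₁ + y₂⁆ =
      t * (1 - t ^ 2) ^ 2 * Q α α + (1 - t) ^ 2 * Q (c + d) (c + d) := by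
    conv_lhs => rw [hZ, stretch_add hQ 𝔥.toSubmodule t _ dm dz]
    simp only [map_add, map_smul, LinearMap.add_apply, LinearMap.smul_apply, smul_eq_mul,
      hd' α hα', hQ.symm c α, hQ.symm d α, hc' α hα']
    ring
  have e4 : Q ⁅x₁ + x₂, y₁ + y₂⁆ ((t * (t - 1)) • α + (t - 1) • d) +
      Q ⁅x₁ + x₂, y₁ + y₂⁆ ((t * (t - 1)) • α + (t - 1) • c) =
      2 * (1 - t ^ 2) * (t * (t - 1)) * Q α α - (1 - t) ^ 2 * Q (c + d) (c + d) := by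
    rw [hZ]
    simp only [map_add, map_smul, LinearMap.add_apply, LinearMap.smul_apply, smul_eq_mul,
      hd' α hα', hQ.symm c α, hQ.symm d α, hc' α hα']
    ring
  simp only [map_sub, LinearMap.sub_apply]
  linear_combination k1 - k2 - k3 / 2 - e1 + e2 - s4 / 2 - s5 / 2 - e3 / 2 - e4 / 2

/-- If the enlarged metric has non-negative curvature, then projecting a commuting pair to `𝔥` gives
a commuting pair. -/
theorem lie_orthProj_eq_zero_of_curvature_nonneg {t : ℝ} (ht : 1 < t) {n : V → V → V}
    (hn : IsLeviCivitaProduct (stretch Q hQ 𝔥.toSubmodule t) n)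
    (hcurv : ∀ x y, LinearIndependent ℝ ![x, y] →
      0 ≤ stretch Q hQ 𝔥.toSubmodule t (n x (n y y) - n y (n x y) - n ⁅x, y⁆ y) x) {x y : V}
    (hxy : ⁅x, y⁆ = 0) :
    ⁅orthProj Q hQ 𝔥.toSubmodule x, orthProj Q hQ 𝔥.toSubmodule y⁆ = 0 := by
  set P := orthProj Q hQ 𝔥.toSubmodule with hP
  have hdec : ∀ v, P v ∈ 𝔥 ∧ ∀ w ∈ 𝔥, Q w (v - P v) = 0 := fun v ↦
    ⟨orthProj_mem hQ 𝔥.toSubmodule v, fun w hw ↦ apply_sub_orthProj hQ 𝔥.toSubmodule hw v⟩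
  have ht0 : t ≠ 0 := by positivity
  -- The curvature is tested on `t⁻¹ • P v + (v - P v)`: multiplying its `𝔥`-part by `t` recovers
  -- `v`, so the hypothesis of `curvature_of_commute` is exactly `⁅x, y⁆ = 0`.
  have hin : ∀ v, P (t⁻¹ • P v + (v - P v)) = t⁻¹ • P v := fun v ↦ by
    rw [map_add, map_smul, hP, orthProj_of_mem hQ _ (hdec v).1,
      orthProj_of_orthogonal hQ _ (hdec v).2, add_zero]
  have hφ : ∀ v, t • t⁻¹ • P v + (v - P v) = v := fun v ↦ by rw [smul_inv_smul₀ ht0]; abel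
  have hc := curvature_of_commute hQ hinv 𝔥 (zero_lt_one.trans ht) hn
    (𝔥.smul_mem t⁻¹ (hdec x).1) (hdec x).2 (𝔥.smul_mem t⁻¹ (hdec y).1) (hdec y).2
    (by rw [hφ, hφ, hxy])
  suffices h : ⁅t⁻¹ • P x, t⁻¹ • P y⁆ = 0 by
    simpa [ht0] using h
  by_cases hli : LinearIndependent ℝ ![t⁻¹ • P x + (x - P x), t⁻¹ • P y + (y - P y)]
  · have h1 := hcurv _ _ hli
    rw [hc] at h1
    have h2 : 0 < (t - 1) ^ 3 * t * (3 * t + 1) / 4 := by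
      have : 0 < t - 1 := by linarith
      positivity
    refine hQ.eq_zero (le_antisymm ?_ (hQ.nonneg _))
    by_contra h3
    have := mul_pos h2 (not_le.1 h3)
    linarith
  -- A dependent pair spans no plane, but its projections are dependent too and so commute.
  · rw [LinearIndependent.pair_iff] at hli
    push Not at hli
    obtain ⟨a, b, hab, hne⟩ := hli
    have h1 := congrArg P hab
    rw [map_add, map_smul, map_smul, hin, hin, map_zero] at h1
    by_cases ha : a = 0
    · have hb := hne ha
      rw [ha, zero_smul, zero_add, smul_eq_zero_iff_right hb] at h1
      rw [h1, lie_zero]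
    · have h2 := congrArg (⁅·, t⁻¹ • P y⁆) h1
      simp only [add_lie, smul_lie a, smul_lie b, lie_self, smul_zero, add_zero, zero_lie] at h2
      exact (smul_eq_zero_iff_right ha).1 h2

end StretchedCurvature

/-! ### Differentiating conditions on commuting pairs along derivations. -/

section Derivations

/-- The flow `exp (s D)` of a derivation consists of automorphisms of `b`, so it preserves the pairs
with `b x y = 0`. Hence `F` vanishes along the orbit, and its derivative at `s = 0` is the claim. -/
theorem apply_derivation_add_eq_zero_of_normed {V : Type*} [NormedAddCommGroup V]
    [NormedSpace ℝ V] [FiniteDimensional ℝ V] (b : V →ₗ[ℝ] V →ₗ[ℝ] V)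
    (D : V →ₗ[ℝ] V) (hD : ∀ x y, D (b x y) = b (D x) y + b x (D y)) (F : V →ₗ[ℝ] V →ₗ[ℝ] V)
    (hF : ∀ x y, b x y = 0 → F x y = 0) {x y : V} (hxy : b x y = 0) :
    F (D x) y + F x (D y) = 0 := by
  set A : V →L[ℝ] V := LinearMap.toContinuousLinearMap D
  let u : V → ℝ → V := fun v s ↦ NormedSpace.exp (s • A) v
  have hu : ∀ v s, HasDerivAt (u v) (D (u v s)) s := fun v s ↦ by
    have := (hasDerivAt_exp_smul_const' (𝕂 := ℝ) A s).clm_apply (hasDerivAt_const s v)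
    rw [map_zero, add_zero] at this
    exact this
  have hu0 : ∀ v, u v 0 = v := fun v ↦ by simp [u, NormedSpace.exp_zero]
  have hbil : ∀ (C : V →ₗ[ℝ] V →ₗ[ℝ] V) (s : ℝ),
      HasDerivAt (fun s ↦ C (u x s) (u y s)) (C (D (u x s)) (u y s) + C (u x s) (D (u y s))) s := by
    intro C s
    let C' := LinearMap.toContinuousBilinearMap (𝕜 := ℝ) C
    have := (C'.hasFDerivAt.comp_hasDerivAt s (hu x s)).clm_apply (hu y s)
    exact this
  have hg : ∀ s, b (u x s) (u y s) = 0 := by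
    intro s
    -- Transporting the product back by `exp (-r D)` makes it constant in `r`; it starts at zero.
    have hk : ∀ r, HasDerivAt (fun r ↦ NormedSpace.exp (r • (-A)) (b (u x r) (u y r))) 0 r := by
      intro r
      have h1 := (hasDerivAt_exp_smul_const (𝕂 := ℝ) (-A) r).clm_apply (hbil b r)
      rw [← hD] at h1
      convert h1 using 1
      simp [A]
    have hconst := is_const_of_deriv_eq_zero (fun r ↦ (hk r).differentiableAt)
      (fun r ↦ (hk r).deriv) s 0
    simp only [hu0, hxy, map_zero] at hconst
    let : NormedAlgebra ℚ (V →L[ℝ] V) := NormedAlgebra.restrictScalars ℚ ℝ _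
    obtain ⟨e, he⟩ := NormedSpace.isUnit_exp (s • (-A))
    have h2 : (e⁻¹.val * e.val) (b (u x s) (u y s)) = 0 := by
      rw [he, mul_apply_eq_comp, hconst, map_zero]
    simpa using h2
  have h0 := hbil F 0
  rw [hu0, hu0, show (fun s ↦ F (u x s) (u y s)) = fun _ ↦ 0 from funext fun s ↦ hF _ _ (hg s)] at h0
  exact h0.unique (hasDerivAt_const _ _)

variable {V : Type*} [LieRing V] [LieAlgebra ℝ V] [FiniteDimensional ℝ V]

/-- A bilinear map vanishing on all commuting pairs of a Lie algebra is, on these pairs,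
infinitesimally invariant under the adjoint representation. -/
theorem apply_lie_add_eq_zero_of_commute {Q : LinearMap.BilinForm ℝ V} (hQ : IsInnerProduct Q)
    (F : V →ₗ[ℝ] V →ₗ[ℝ] V) (hF : ∀ x y, ⁅x, y⁆ = 0 → F x y = 0) {x y : V} (hxy : ⁅x, y⁆ = 0)
    (z : V) : F ⁅z, x⁆ y + F x ⁅z, y⁆ = 0 := by
  let : NormedAddCommGroup V := hQ.core.toNormedAddCommGroup
  let : InnerProductSpace ℝ V := InnerProductSpace.ofCore hQ.core.toCore
  exact apply_derivation_add_eq_zero_of_normed (LieModule.toEnd ℝ V V : V →ₗ[ℝ] V →ₗ[ℝ] V)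
    (LieModule.toEnd ℝ V V z) (fun x y ↦ leibniz_lie z x y) F hF hxy

end Derivations

/-! ### Compact Lie algebras of rank one. -/

section RankOne

variable {V : Type*} [LieRing V] [LieAlgebra ℝ V]
  {Q : LinearMap.BilinForm ℝ V} (hQ : IsInnerProduct Q) (hinv : IsAdInvariant Q)
include hQ hinv

theorem IsAdInvariant.apply_lie_self (x v : V) : Q v ⁅x, v⁆ = 0 := by
  have := hinv.swap x v v
  rw [hQ.symm] at this
  linarith

variable [FiniteDimensional ℝ V]

/-- Since `ad x` is skew, `Q ⁅x, ·⁆ ⁅x, ·⁆` is the form of the operator `-(ad x)²`, so a Rayleigh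
minimizer on the invariant subspace `R` is an eigenvector for its least eigenvalue. -/
theorem exists_minimal_ad_eigenvector {x : V} {R : Submodule ℝ V} (hR : R ≠ ⊥)
    (hx : ∀ u ∈ R, ⁅x, u⁆ ∈ R) :
    ∃ u ∈ R, u ≠ 0 ∧ ∃ μ : ℝ, ⁅x, ⁅x, u⁆⁆ = -(μ • u) ∧ Q ⁅x, u⁆ ⁅x, u⁆ = μ * Q u u ∧
      ∀ v ∈ R, μ * Q v v ≤ Q ⁅x, v⁆ ⁅x, v⁆ := by
  obtain ⟨u, hu, hu0, μ, h1, h2⟩ := exists_rayleigh_minimizer_mem hR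
    (A := Q.compl₁₂ (LieModule.toEnd ℝ V V x) (LieModule.toEnd ℝ V V x)) (B := Q)
    (fun _ _ _ _ ↦ hQ.symm _ _) (fun _ _ _ _ ↦ hQ.symm _ _) (fun y _ hy ↦ hQ.pos y hy)
  simp only [LinearMap.compl₁₂_apply, LieModule.toEnd_apply_apply] at h1 h2
  refine ⟨u, hu, hu0, μ, ?_, h1 u hu, h2⟩
  rw [eq_neg_iff_add_eq_zero]
  refine hQ.eq_zero ?_
  have h := h1 _ (R.add_mem (hx _ (hx _ hu)) (R.smul_mem μ hu))
  obtain ⟨z, hz⟩ : ∃ z, z = ⁅x, ⁅x, u⁆⁆ + μ • u := ⟨_, rfl⟩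
  rw [← hz] at h ⊢
  nth_rw 1 [hz]
  rw [map_add, LinearMap.add_apply, hinv.swap x ⁅x, u⁆, h, map_smul, LinearMap.smul_apply,
    smul_eq_mul, neg_add_cancel]

/-- In a representation of `𝔰𝔬(3)`, normalized such that the roots are `± i`, some eigenvalue of `x`
has absolute value less than `1`. -/
theorem eq_bot_of_so3_triple {x v w : V} (hxv : ⁅x, v⁆ = w) (hxw : ⁅x, w⁆ = -v) (hvw : ⁅v, w⁆ = x)
    {R : Submodule ℝ V} (hx : ∀ u ∈ R, ⁅x, u⁆ ∈ R) (hv : ∀ u ∈ R, ⁅v, u⁆ ∈ R)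
    (hw : ∀ u ∈ R, ⁅w, u⁆ ∈ R) (hR : ∀ u ∈ R, Q u u ≤ Q ⁅x, u⁆ ⁅x, u⁆) : R = ⊥ := by
  by_contra hne
  obtain ⟨u, hu, hu0, μ, hxx, h1, h2⟩ := exists_minimal_ad_eigenvector hQ hinv hne hx
  have hμ : 1 ≤ μ := by
    have := hR u hu
    rw [h1] at this
    exact (le_mul_iff_one_le_left (hQ.pos u hu0)).1 this
  set b := √μ
  have hb : b ^ 2 = μ := Real.sq_sqrt (by linarith)
  have hb1 : 1 ≤ b := Real.one_le_sqrt.2 hμ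
  have hb0 : b ≠ 0 := by positivity
  obtain ⟨j, hj⟩ : ∃ j, ⁅x, u⁆ = b • j := ⟨b⁻¹ • ⁅x, u⁆, by rw [smul_inv_smul₀ hb0]⟩
  have hjR : j ∈ R := by
    have := R.smul_mem b⁻¹ (hx u hu)
    rwa [hj, inv_smul_smul₀ hb0] at this
  have hxj : ⁅x, j⁆ = -(b • u) := by
    rw [hj, lie_smul, ← hb, pow_two, mul_smul, ← smul_neg] at hxx
    exact smul_right_injective V hb0 hxx
  -- In real form, a ladder operator is applied to the weight plane of `u, j`: it lowers the weight
  -- `b` to `b - 1`. Minimality of `b` and `b ≥ 1` force the result to vanish.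
  have hf : ⁅x, ⁅v, u⁆ + ⁅w, j⁆⁆ = (b - 1) • (⁅v, j⁆ - ⁅w, u⁆) := by
    rw [lie_add, leibniz_lie x v, leibniz_lie x w, hxv, hxw, hj, hxj, lie_smul, lie_neg, lie_smul,
      neg_lie]
    module
  have hg : ⁅x, ⁅v, j⁆ - ⁅w, u⁆⁆ = -((b - 1) • (⁅v, u⁆ + ⁅w, j⁆)) := by
    rw [lie_sub, leibniz_lie x v, leibniz_lie x w, hxv, hxw, hj, hxj, lie_smul, lie_neg, lie_smul,
      neg_lie]
    module
  have hf2 := h2 _ (R.add_mem (hv _ hu) (hw _ hjR))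
  have hg2 := h2 _ (R.sub_mem (hv _ hjR) (hw _ hu))
  rw [hf, ← hb] at hf2
  rw [hg, ← hb] at hg2
  obtain ⟨f, hfdef⟩ : ∃ f, ⁅v, u⁆ + ⁅w, j⁆ = f := ⟨_, rfl⟩
  obtain ⟨g, hgdef⟩ : ∃ g, ⁅v, j⁆ - ⁅w, u⁆ = g := ⟨_, rfl⟩
  simp only [hfdef, hgdef, map_neg, map_smul, LinearMap.neg_apply, LinearMap.smul_apply,
    smul_eq_mul] at hf2 hg2
  have hff := hQ.nonneg f
  have hgg := hQ.nonneg g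
  have hf0 : f = 0 := hQ.eq_zero (by nlinarith)
  have hg0 : g = 0 := hQ.eq_zero (by nlinarith)
  rw [hf0, add_eq_zero_iff_eq_neg] at hfdef
  rw [hg0, sub_eq_zero] at hgdef
  -- The sign contradiction for an extremal weight vector: `x = ⁅v, w⁆` acts on it with the wrong
  -- sign.
  have key : b * Q j j = -Q ⁅w, u⁆ ⁅w, u⁆ - Q ⁅w, j⁆ ⁅w, j⁆ := by
    rw [← smul_eq_mul, ← LinearMap.smul_apply, ← map_smul, ← hj, ← hvw, lie_lie, map_sub,
      LinearMap.sub_apply, hinv.swap v, hinv.swap w ⁅v, u⁆, hgdef, hfdef, map_neg,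
      LinearMap.neg_apply]
    ring
  have hj0 : j = 0 := hQ.eq_zero <| by
    nlinarith [hQ.nonneg ⁅w, u⁆, hQ.nonneg ⁅w, j⁆, hQ.nonneg j]
  rw [hj0, lie_zero, eq_comm, neg_eq_zero, smul_eq_zero_iff_right hb0] at hxj
  exact hu0 hxj

/-- Take `v` of least eigenvalue `μ` for `-(ad x)²` on `L ∩ x^⊥`. Then `⁅v, ⁅x, v⁆⁆` commutes with
`x`, so it is a multiple of `x`, a positive one by invariance. Rescaling `x` by `μ^(-1/2)`, and then
`v`, normalizes the triple; minimality of `μ` becomes the last inequality. -/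
theorem exists_so3_triple (L : LieSubalgebra ℝ V) {x : V} (hx : x ∈ L)
    (hcent : ∀ v ∈ L, ⁅x, v⁆ = 0 → ∃ κ : ℝ, v = κ • x) {v₀ : V} (hv₀ : v₀ ∈ L) (hv₀' : v₀ ≠ 0)
    (hv₀x : Q x v₀ = 0) :
    ∃ r : ℝ, r ≠ 0 ∧ ∃ v ∈ L, ⁅r • x, ⁅r • x, v⁆⁆ = -v ∧ ⁅v, ⁅r • x, v⁆⁆ = r • x ∧ v ≠ 0 ∧
      Q x v = 0 ∧ ∀ u ∈ L, Q x u = 0 → Q u u ≤ Q ⁅r • x, u⁆ ⁅r • x, u⁆ := by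
  have hne : L.toSubmodule ⊓ LinearMap.ker (Q x) ≠ ⊥ := fun h ↦
    hv₀' ((Submodule.mem_bot ℝ).1 (h ▸ ⟨hv₀, hv₀x⟩))
  obtain ⟨v, ⟨hvL, hvx⟩, hv0, μ, hxx, h1, h2⟩ := exists_minimal_ad_eigenvector hQ hinv
    (x := x) hne (fun u hu ↦ ⟨L.lie_mem hx hu.1, by
      change Q x ⁅x, u⁆ = 0
      rw [← hinv, lie_self, map_zero, LinearMap.zero_apply]⟩)
  replace hvx : Q x v = 0 := hvx
  have hx0 : x ≠ 0 := by
    rintro rfl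
    obtain ⟨κ, hκ⟩ := hcent v hvL (zero_lie v)
    exact hv0 (by rw [hκ, smul_zero])
  have hxv : ⁅x, v⁆ ≠ 0 := by
    intro h
    obtain ⟨κ, rfl⟩ := hcent v hvL h
    rw [map_smul, smul_eq_mul, mul_eq_zero] at hvx
    rcases hvx with h | h
    · exact hv0 (by rw [h, zero_smul])
    · exact (hQ.pos x hx0).ne' h
  have hμ : 0 < μ := by
    have := hQ.pos _ hxv
    rw [h1] at this
    exact pos_of_mul_pos_left this (hQ.nonneg v)
  obtain ⟨r, hr, hrμ⟩ : ∃ r : ℝ, 0 < r ∧ r ^ 2 * μ = 1 :=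
    ⟨(√μ)⁻¹, by positivity, by rw [inv_pow, Real.sq_sqrt hμ.le, inv_mul_cancel₀ hμ.ne']⟩
  obtain ⟨κ, hκ⟩ := hcent ⁅v, ⁅r • x, v⁆⁆ (L.lie_mem hvL (L.lie_mem (L.smul_mem _ hx) hvL)) (by
    rw [leibniz_lie, smul_lie, lie_smul, lie_smul, hxx, lie_self, lie_smul, lie_neg, lie_smul,
      lie_self]
    simp)
  have hκ0 : 0 < κ * r⁻¹ := by
    have h3 : κ * Q x x = r * (μ * Q v v) := by
      rw [← smul_eq_mul, ← LinearMap.smul_apply, ← map_smul, ← hκ, smul_lie, lie_smul, map_smul,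
        LinearMap.smul_apply, smul_eq_mul, hinv, ← lie_skew, hxx, neg_neg, map_smul, smul_eq_mul]
    have h4 : 0 < κ * Q x x := by
      rw [h3]
      have := hQ.pos v hv0
      positivity
    have := pos_of_mul_pos_left h4 (hQ.nonneg x)
    positivity
  obtain ⟨s, hs, hsκ⟩ : ∃ s : ℝ, 0 < s ∧ s ^ 2 * (κ * r⁻¹) = 1 :=
    ⟨(√(κ * r⁻¹))⁻¹, by positivity, by
      rw [inv_pow, Real.sq_sqrt hκ0.le, inv_mul_cancel₀ hκ0.ne']⟩
  refine ⟨r, hr.ne', s • v, L.smul_mem _ hvL, ?_, ?_, smul_ne_zero hs.ne' hv0, ?_, ?_⟩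
  · simp only [smul_lie, lie_smul, hxx]
    have : s • r • r • -(μ • v) = (r ^ 2 * μ) • -(s • v) := by module
    rw [this, hrμ, one_smul]
  · rw [lie_smul, lie_smul, smul_lie, hκ, ← smul_assoc, ← smul_assoc]
    congr 1
    simp only [smul_eq_mul]
    field_simp at hsκ ⊢
    linarith
  · rw [map_smul, hvx, smul_zero]
  · intro u hu hux
    have := h2 u ⟨hu, hux⟩
    simp only [smul_lie, map_smul, LinearMap.smul_apply, smul_eq_mul]
    calc Q u u = r ^ 2 * (μ * Q u u) := by rw [← mul_assoc, hrμ, one_mul]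
      _ ≤ r ^ 2 * Q ⁅x, u⁆ ⁅x, u⁆ := by gcongr
      _ = _ := by ring

/-- A compact Lie algebra `L` of rank one is minimal among the subspaces which properly contain a
maximal torus `ℝ x` and are invariant under it. -/
theorem le_of_rank_one (L : LieSubalgebra ℝ V) {x : V} (hx : x ∈ L)
    (hcent : ∀ v ∈ L, ⁅x, v⁆ = 0 → ∃ κ : ℝ, v = κ • x) {S : Submodule ℝ V}
    (hSL : S ≤ L.toSubmodule) (hxS : x ∈ S) (hS : ∀ v ∈ S, ⁅x, v⁆ ∈ S)
    {v₀ : V} (hv₀ : v₀ ∈ S) (hv₀' : v₀ ≠ 0) (hv₀x : Q x v₀ = 0) : L.toSubmodule ≤ S := by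
  obtain ⟨r, hr, v, hvL, h1, h2, hv0, hxv, h3⟩ :=
    exists_so3_triple hQ hinv L hx hcent (hSL hv₀) hv₀' hv₀x
  obtain ⟨y, hy⟩ : ∃ y, y = r • x := ⟨_, rfl⟩
  have hxy : x = r⁻¹ • y := by rw [hy, inv_smul_smul₀ hr]
  rw [← hy] at h1 h2 h3
  obtain ⟨w, hw⟩ : ∃ w, ⁅y, v⁆ = w := ⟨_, rfl⟩
  rw [hw] at h1 h2
  have hyL : y ∈ L := hy ▸ L.smul_mem r hx
  have hwL : w ∈ L := hw ▸ L.lie_mem hyL hvL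
  have hyS : ∀ u ∈ S, ⁅y, u⁆ ∈ S := fun u hu ↦ by
    rw [hy, smul_lie]; exact S.smul_mem _ (hS u hu)
  have hQy : ∀ u, Q x u = 0 ↔ Q y u = 0 := fun u ↦ by
    rw [hy, map_smul, LinearMap.smul_apply, smul_eq_zero_iff_right hr]
  have hyv : Q y v = 0 := (hQy v).1 hxv
  have hvw : Q v w = 0 := hw ▸ hinv.apply_lie_self hQ y v
  have hyw : Q y w = 0 := by rw [← hw, ← hinv, lie_self, map_zero, LinearMap.zero_apply]
  have hww : Q w w = Q v v := by
    nth_rw 1 [← hw]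
    rw [hinv.swap, h1, map_neg, neg_neg]
  have skew : ∀ a b c : V, Q a ⁅b, c⁆ = -Q ⁅b, a⁆ c := fun a b c ↦ by rw [hinv.swap, neg_neg]
  have hvy : ⁅v, y⁆ = -w := by rw [← lie_skew, hw]
  have hwy : ⁅w, y⁆ = v := by rw [← lie_skew, h1, neg_neg]
  have hwv : ⁅w, v⁆ = -y := by rw [← lie_skew, h2]
  -- The part of `L` orthogonal to the triple is invariant under it, and all eigenvalues of `-(ad
  -- y)²` there are at least `1`, so it vanishes and `L` is spanned by the triple.
  have hrest : L.toSubmodule ⊓ (LinearMap.ker (Q y) ⊓ (LinearMap.ker (Q v) ⊓ LinearMap.ker (Q w)))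
      = ⊥ := by
    refine eq_bot_of_so3_triple hQ hinv hw h1 h2 ?_ ?_ ?_ ?_
    · rintro u ⟨hu, huy, huv, huw⟩
      change Q y u = 0 at huy
      change Q v u = 0 at huv
      change Q w u = 0 at huw
      refine ⟨L.lie_mem hyL hu, ?_, ?_, ?_⟩ <;> change Q _ _ = 0 <;>
        simp [skew, hw, h1, huv, huw]
    · rintro u ⟨hu, huy, huv, huw⟩
      change Q y u = 0 at huy
      change Q v u = 0 at huv
      change Q w u = 0 at huw
      refine ⟨L.lie_mem hvL hu, ?_, ?_, ?_⟩ <;> change Q _ _ = 0 <;>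
        simp [skew, h2, hvy, huy, huw]
    · rintro u ⟨hu, huy, huv, huw⟩
      change Q y u = 0 at huy
      change Q v u = 0 at huv
      change Q w u = 0 at huw
      refine ⟨L.lie_mem hwL hu, ?_, ?_, ?_⟩ <;> change Q _ _ = 0 <;>
        simp [skew, hwv, hwy, huy, huv]
    · rintro u ⟨hu, huy, -⟩
      exact h3 u hu ((hQy u).2 huy)
  have hvv := (hQ.pos v hv0).ne'
  have hspan : ∀ u ∈ L, Q x u = 0 → u = (Q v u / Q v v) • v + (Q w u / Q v v) • w := by
    intro u hu hux
    rw [hQy] at hux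
    rw [← sub_eq_zero, ← Submodule.mem_bot ℝ, ← hrest]
    refine ⟨L.sub_mem hu (L.add_mem (L.smul_mem _ hvL) (L.smul_mem _ hwL)), ?_, ?_, ?_⟩ <;> change Q _ _ = 0 <;>
      simp [hux, hyv, hyw, hvw, hQ.symm w v, hww, hvv]
  have hdec := hspan v₀ (hSL hv₀) hv₀x
  set a := Q v v₀ / Q v v
  set b := Q w v₀ / Q v v
  have hab : a ^ 2 + b ^ 2 ≠ 0 := by
    intro h
    have ha : a = 0 := by nlinarith [sq_nonneg a, sq_nonneg b]
    have hb : b = 0 := by nlinarith [sq_nonneg a, sq_nonneg b]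
    rw [ha, hb, zero_smul, zero_smul, add_zero] at hdec
    exact hv₀' hdec
  have hyv₀ : ⁅y, v₀⁆ = a • w - b • v := by
    rw [hdec, lie_add, lie_smul, lie_smul, hw, h1, smul_neg, sub_eq_add_neg]
  -- On the plane of `v, w`, `ad y` is a quarter turn, so `v₀` and `⁅y, v₀⁆` already span it.
  have hvS : v ∈ S := by
    rw [← Submodule.smul_mem_iff S hab]
    have : (a ^ 2 + b ^ 2) • v = a • v₀ - b • ⁅y, v₀⁆ := by
      rw [hyv₀, hdec]
      module
    rw [this]
    exact S.sub_mem (S.smul_mem _ hv₀) (S.smul_mem _ (hyS _ hv₀))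
  have hwS : w ∈ S := hw ▸ hyS v hvS
  intro l hl
  have hx0 : Q x x ≠ 0 := by
    refine (hQ.pos x ?_).ne'
    rintro rfl
    obtain ⟨κ, hκ⟩ := hcent v hvL (zero_lie v)
    exact hv0 (by rw [hκ, smul_zero])
  have := hspan (l - (Q x l / Q x x) • x) (L.sub_mem hl (L.smul_mem _ hx)) (by simp [hx0])
  rw [sub_eq_iff_eq_add] at this
  rw [this]
  exact S.add_mem (S.add_mem (S.smul_mem _ hvS) (S.smul_mem _ hwS)) (S.smul_mem _ hxS)

end RankOne

/-! ### Simple subalgebras whose projection preserves commuting pairs. -/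

section CommutingProjections

variable {V : Type*} [LieRing V] [LieAlgebra ℝ V]

/-- The elements of `S^⊥` which commute with `S`. -/
def orthCentralizer (Q : LinearMap.BilinForm ℝ V) (S : LieSubalgebra ℝ V) : Submodule ℝ V where
  carrier := {y | ∀ w ∈ S, Q w y = 0 ∧ ⁅w, y⁆ = 0}
  add_mem' hx hy w hw := by simp [hx w hw, hy w hw]
  zero_mem' w _ := by simp
  smul_mem' c x hx w hw := by simp [hx w hw]

/-- The orthogonal complement of `S + orthCentralizer Q S`. -/
def effectivePart (Q : LinearMap.BilinForm ℝ V) (S : LieSubalgebra ℝ V) : Submodule ℝ V where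
  carrier := {u | (∀ w ∈ S, Q w u = 0) ∧ ∀ y ∈ orthCentralizer Q S, Q y u = 0}
  add_mem' hx hy :=
    ⟨fun w hw ↦ by simp [hx.1 w hw, hy.1 w hw], fun w hw ↦ by simp [hx.2 w hw, hy.2 w hw]⟩
  zero_mem' := by simp
  smul_mem' c x hx := ⟨fun w hw ↦ by simp [hx.1 w hw], fun w hw ↦ by simp [hx.2 w hw]⟩

/-- The Lie subalgebra `S` is non-abelian and has no proper non-zero ideals. -/
structure IsSimpleSubalgebra (S : LieSubalgebra ℝ V) : Prop where
  eq_bot_or_eq_top : ∀ I : Submodule ℝ V, I ≤ S.toSubmodule → (∀ s ∈ S, ∀ i ∈ I, ⁅s, i⁆ ∈ I) →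
    I = ⊥ ∨ I = S.toSubmodule
  nonabelian : ∃ x ∈ S, ∃ y ∈ S, ⁅x, y⁆ ≠ 0

theorem IsSimpleSubalgebra.eq_zero_of_central {S : LieSubalgebra ℝ V} (hS : IsSimpleSubalgebra S)
    {s : V} (hs : s ∈ S) (h : ∀ x ∈ S, ⁅x, s⁆ = 0) : s = 0 := by
  let I : Submodule ℝ V :=
    { carrier := {s | s ∈ S ∧ ∀ x ∈ S, ⁅x, s⁆ = 0}
      add_mem' := fun ha hb ↦ ⟨S.add_mem ha.1 hb.1, fun x hx ↦ by simp [ha.2 x hx, hb.2 x hx]⟩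
      zero_mem' := ⟨S.zero_mem, by simp⟩
      smul_mem' := fun c a ha ↦ ⟨S.smul_mem c ha.1, fun x hx ↦ by simp [ha.2 x hx]⟩ }
  rcases hS.eq_bot_or_eq_top I (fun _ h ↦ h.1) (fun x hx i hi ↦ by
    rw [hi.2 x hx]; exact I.zero_mem) with hI | hI
  · exact (Submodule.mem_bot ℝ).1 (hI ▸ (⟨hs, h⟩ : s ∈ I))
  · obtain ⟨x, hx, y, hy, hxy⟩ := hS.nonabelian
    exact absurd ((hI ▸ hy : y ∈ I).2 x hx) hxy

variable {Q : LinearMap.BilinForm ℝ V} {S : LieSubalgebra ℝ V}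

section Invariance

variable (hinv : IsAdInvariant Q)
include hinv

theorem lie_mem_orthCentralizer {y y' : V} (hy : y ∈ orthCentralizer Q S)
    (hy' : y' ∈ orthCentralizer Q S) : ⁅y, y'⁆ ∈ orthCentralizer Q S := fun w hw ↦ by
  rw [← hinv, leibniz_lie, (hy w hw).2, (hy' w hw).2]
  simp

theorem lie_mem_effectivePart {w u : V} (hw : w ∈ S) (hu : u ∈ effectivePart Q S) :
    ⁅w, u⁆ ∈ effectivePart Q S :=
  ⟨fun x hx ↦ by rw [← hinv]; exact hu.1 _ (S.lie_mem hx hw), fun y hy ↦ by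
    rw [← hinv, ← lie_skew, (hy w hw).2]; simp⟩

theorem lie_mem_effectivePart' {y u : V} (hy : y ∈ orthCentralizer Q S)
    (hu : u ∈ effectivePart Q S) : ⁅y, u⁆ ∈ effectivePart Q S :=
  ⟨fun x hx ↦ by rw [← hinv, (hy x hx).2]; simp, fun x hx ↦ by
    rw [← hinv]; exact hu.2 _ (lie_mem_orthCentralizer hinv hx hy)⟩

end Invariance

variable [FiniteDimensional ℝ V] (hQ : IsInnerProduct Q) (hinv : IsAdInvariant Q)
  (hS : IsSimpleSubalgebra S)
  (hcomm : ∀ x y : V, ⁅x, y⁆ = 0 →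
    ⁅orthProj Q hQ S.toSubmodule x, orthProj Q hQ S.toSubmodule y⁆ = 0)
include hcomm

theorem lie_orthProj_first_order {x y : V} (hxy : ⁅x, y⁆ = 0) (z : V) :
    ⁅orthProj Q hQ S.toSubmodule ⁅z, x⁆, orthProj Q hQ S.toSubmodule y⁆
      + ⁅orthProj Q hQ S.toSubmodule x, orthProj Q hQ S.toSubmodule ⁅z, y⁆⁆ = 0 :=
  apply_lie_add_eq_zero_of_commute hQ
    ((LieModule.toEnd ℝ V V : V →ₗ[ℝ] V →ₗ[ℝ] V).compl₁₂ (orthProj Q hQ S.toSubmodule)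
      (orthProj Q hQ S.toSubmodule)) hcomm hxy z

theorem lie_orthProj_second_order {x y : V} (hxy : ⁅x, y⁆ = 0) (z : V) :
    ⁅orthProj Q hQ S.toSubmodule ⁅z, ⁅z, x⁆⁆, orthProj Q hQ S.toSubmodule y⁆
      + ⁅orthProj Q hQ S.toSubmodule ⁅z, x⁆, orthProj Q hQ S.toSubmodule ⁅z, y⁆⁆
      + (⁅orthProj Q hQ S.toSubmodule ⁅z, x⁆, orthProj Q hQ S.toSubmodule ⁅z, y⁆⁆
      + ⁅orthProj Q hQ S.toSubmodule x, orthProj Q hQ S.toSubmodule ⁅z, ⁅z, y⁆⁆⁆) = 0 := by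
  let F : V →ₗ[ℝ] V →ₗ[ℝ] V := (LieModule.toEnd ℝ V V : V →ₗ[ℝ] V →ₗ[ℝ] V).compl₁₂
    (orthProj Q hQ S.toSubmodule) (orthProj Q hQ S.toSubmodule)
  have := apply_lie_add_eq_zero_of_commute hQ
    (F.compl₁₂ (LieModule.toEnd ℝ V V z) LinearMap.id
      + F.compl₁₂ LinearMap.id (LieModule.toEnd ℝ V V z))
    (fun x y h ↦ lie_orthProj_first_order hQ hcomm h z) hxy z
  rw [← this]
  simp only [LinearMap.add_apply]
  rfl

include hinv

/-- Here `P x = x` and `P y = 0`, so the first-order condition reads `⁅x, P ⁅z, y⁆⁆ = 0` for every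
`z`; pairing with `w` moves all brackets off `z`. -/
theorem lie_lie_eq_zero_of_orthogonal {x y w : V} (hx : x ∈ S) (hy : ∀ w ∈ S, Q w y = 0)
    (hxy : ⁅x, y⁆ = 0) (hw : w ∈ S) : ⁅⁅w, x⁆, y⁆ = 0 := by
  refine hQ.ext fun z ↦ ?_
  have h := lie_orthProj_first_order hQ hcomm hxy z
  rw [orthProj_of_orthogonal hQ S.toSubmodule hy, orthProj_of_mem hQ S.toSubmodule hx, lie_zero,
    zero_add] at h
  rw [map_zero, LinearMap.zero_apply, hinv, ← lie_skew y z, map_neg,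
    ← apply_orthProj hQ S.toSubmodule (S.lie_mem hw hx), hinv, h, map_zero, neg_zero]

include hS

/-- By `lie_lie_eq_zero_of_orthogonal`, the elements of `S` commuting with `y` form an ideal of `S`;
it contains `x ≠ 0`, so it is all of `S`. -/
theorem mem_orthCentralizer {x y : V} (hx : x ∈ S) (hx0 : x ≠ 0) (hy : ∀ w ∈ S, Q w y = 0)
    (hxy : ⁅x, y⁆ = 0) : y ∈ orthCentralizer Q S := by
  let I : Submodule ℝ V :=
    { carrier := {s | s ∈ S ∧ ⁅s, y⁆ = 0}
      add_mem' := fun ha hb ↦ ⟨S.add_mem ha.1 hb.1, by simp [ha.2, hb.2]⟩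
      zero_mem' := ⟨S.zero_mem, by simp⟩
      smul_mem' := fun c a ha ↦ ⟨S.smul_mem c ha.1, by simp [ha.2]⟩ }
  rcases hS.eq_bot_or_eq_top I (fun _ h ↦ h.1) (fun w hw i hi ↦
    ⟨S.lie_mem hw hi.1, lie_lie_eq_zero_of_orthogonal hQ hinv hcomm hi.1 hy hi.2 hw⟩) with hI | hI
  · exact absurd ((Submodule.mem_bot ℝ).1 (hI ▸ (⟨hx, hxy⟩ : x ∈ I))) hx0
  · exact fun w hw ↦ ⟨hy w hw, (hI ▸ hw : w ∈ I).2⟩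

theorem eq_zero_of_lie_eq_zero {x u : V} (hx : x ∈ S) (hx0 : x ≠ 0) (hu : u ∈ effectivePart Q S)
    (hxu : ⁅x, u⁆ = 0) : u = 0 :=
  hQ.eq_zero (hu.2 u (mem_orthCentralizer hQ hinv hS hcomm hx hx0 hu.1 hxu))

/-- For `z` in the effective part, the second-order condition makes `P ⁅z, ⁅z, y⁆⁆` central in `S`,
hence zero. This is a quadratic identity in `z`, whose polarization yields the claim. -/
theorem lie_orthCentralizer_effectivePart {y u : V} (hy : y ∈ orthCentralizer Q S)
    (hu : u ∈ effectivePart Q S) : ⁅y, u⁆ = 0 := by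
  have hP : ∀ z ∈ effectivePart Q S, orthProj Q hQ S.toSubmodule ⁅z, ⁅z, y⁆⁆ = 0 := by
    intro z hz
    refine hS.eq_zero_of_central (orthProj_mem hQ S.toSubmodule _) fun x hx ↦ ?_
    have h := lie_orthProj_second_order hQ hcomm (hy x hx).2 z
    have hzy : orthProj Q hQ S.toSubmodule ⁅z, y⁆ = 0 := by
      rw [← lie_skew, map_neg, orthProj_of_orthogonal hQ S.toSubmodule
        (lie_mem_effectivePart' hinv hy hz).1, neg_zero]
    rwa [orthProj_of_orthogonal hQ S.toSubmodule fun w hw ↦ (hy w hw).1, hzy,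
      orthProj_of_mem hQ S.toSubmodule hx, lie_zero, lie_zero, zero_add, zero_add, zero_add] at h
  have hquad : ∀ w ∈ S, ∀ z ∈ effectivePart Q S, Q ⁅w, z⁆ ⁅y, z⁆ = 0 := by
    intro w hw z hz
    have h := apply_orthProj hQ S.toSubmodule hw ⁅z, ⁅z, y⁆⁆
    rw [hP z hz, map_zero, ← hinv] at h
    rw [← lie_skew y z, map_neg, ← h, neg_zero]
  obtain ⟨w, hw, w', hw', hww⟩ := hS.nonabelian
  have hw0 : w ≠ 0 := by rintro rfl; exact hww (zero_lie _)
  have hwy : ∀ z : V, ⁅w, ⁅y, z⁆⁆ = ⁅y, ⁅w, z⁆⁆ := fun z ↦ by rw [leibniz_lie, (hy w hw).2]; simp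
  -- Polarized at `u` and `⁅w, ⁅y, u⁆⁆`, both cross terms equal minus the squared length of the
  -- latter, because `ad w` and `ad y` commute.
  have hzero : ⁅w, ⁅y, u⁆⁆ = 0 := by
    have hm := lie_mem_effectivePart hinv hw (lie_mem_effectivePart' hinv hy hu)
    set z := ⁅w, ⁅y, u⁆⁆ with hz
    have h := hquad w hw (u + z) ((effectivePart Q S).add_mem hu hm)
    simp only [lie_add, map_add, LinearMap.add_apply, hquad w hw u hu, hquad w hw z hm] at h
    have e1 : Q ⁅w, u⁆ ⁅y, z⁆ = -Q z z := by
      rw [← neg_eq_iff_eq_neg, ← hinv.swap, hz, hwy]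
    have e2 : Q ⁅w, z⁆ ⁅y, u⁆ = -Q z z := by
      rw [hinv.swap, hz]
    rw [e1, e2] at h
    exact hQ.eq_zero (by linarith)
  exact eq_zero_of_lie_eq_zero hQ hinv hS hcomm hw hw0 (lie_mem_effectivePart' hinv hy hu) hzero

/-- As `ad x` and `ad y` commute and are skew, `Q ⁅y, ·⁆ ⁅x, ·⁆` is symmetric. A common eigenvector
`u` with `Q ⁅x, ·⁆ ⁅x, ·⁆` is killed by `y - κ • x`, which contradicts injectivity on the effective
part unless `y = κ • x`. -/
theorem eq_smul_of_commute (hne : effectivePart Q S ≠ ⊥) {x y : V} (hx : x ∈ S) (hx0 : x ≠ 0)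
    (hy : y ∈ S) (hxy : ⁅x, y⁆ = 0) : ∃ κ : ℝ, y = κ • x := by
  have hcom : ∀ z : V, ⁅x, ⁅y, z⁆⁆ = ⁅y, ⁅x, z⁆⁆ := fun z ↦ by rw [leibniz_lie, hxy]; simp
  obtain ⟨u, hu, hu0, κ, h1, -⟩ := exists_rayleigh_minimizer_mem hne
    (A := Q.compl₁₂ (LieModule.toEnd ℝ V V y) (LieModule.toEnd ℝ V V x))
    (B := Q.compl₁₂ (LieModule.toEnd ℝ V V x) (LieModule.toEnd ℝ V V x))
    (fun a _ b _ ↦ by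
      simp only [LinearMap.compl₁₂_apply, LieModule.toEnd_apply_apply]
      rw [hQ.symm ⁅y, b⁆, hinv.swap, hinv.swap, hcom]) (fun _ _ _ _ ↦ hQ.symm _ _)
    (fun a ha ha0 ↦ hQ.pos _ fun h ↦ ha0 (eq_zero_of_lie_eq_zero hQ hinv hS hcomm hx hx0 ha h))
  simp only [LinearMap.compl₁₂_apply, LieModule.toEnd_apply_apply] at h1
  refine ⟨κ, ?_⟩
  have hyx : y - κ • x ∈ S := S.sub_mem hy (S.smul_mem κ hx)
  have hv := lie_mem_effectivePart hinv hyx hu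
  have hxv : ⁅x, ⁅y - κ • x, u⁆⁆ = 0 := by
    have hm := lie_mem_effectivePart hinv hx hv
    refine hQ.eq_zero ?_
    have := h1 _ hm
    obtain ⟨m, hm'⟩ : ∃ m, m = ⁅x, ⁅y - κ • x, u⁆⁆ := ⟨_, rfl⟩
    rw [← hm'] at this ⊢
    nth_rw 1 [hm']
    rw [hinv.swap, sub_lie, map_sub, LinearMap.sub_apply, this, smul_lie, map_smul,
      LinearMap.smul_apply, smul_eq_mul, sub_self, neg_zero]
  have := eq_zero_of_lie_eq_zero hQ hinv hS hcomm hx hx0 hv hxv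
  by_contra hne'
  exact hu0 (eq_zero_of_lie_eq_zero hQ hinv hS hcomm hyx (sub_ne_zero.2 hne') hu this)

theorem effectivePart_eq_bot : effectivePart Q S = ⊥ := by
  by_contra hne
  obtain ⟨x, hx, x', hx', hxx'⟩ := hS.nonabelian
  have hx0 : x ≠ 0 := by rintro rfl; exact hxx' (zero_lie _)
  have hsplit : ∀ v, (∀ y ∈ orthCentralizer Q S, Q y v = 0) →
      v - orthProj Q hQ S.toSubmodule v ∈ effectivePart Q S := fun v hv ↦
    ⟨fun w hw ↦ apply_sub_orthProj hQ S.toSubmodule hw v, fun y hy ↦ by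
      rw [map_sub, hv y hy, hQ.symm, (hy _ (orthProj_mem hQ S.toSubmodule v)).1, sub_zero]⟩
  -- This is `S` plus the effective part. It is closed under brackets because `orthCentralizer Q S`
  -- commutes with both summands.
  let L : LieSubalgebra ℝ V :=
    { carrier := {v | ∀ y ∈ orthCentralizer Q S, Q y v = 0}
      add_mem' := fun ha hb y hy ↦ by simp [ha y hy, hb y hy]
      zero_mem' := by simp
      smul_mem' := fun c a ha y hy ↦ by simp [ha y hy]
      lie_mem' := fun {a b} ha hb y hy ↦ by
        have : ⁅y, a⁆ = 0 := by
          rw [← add_sub_cancel (orthProj Q hQ S.toSubmodule a) a, lie_add, ← lie_skew,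
            (hy _ (orthProj_mem hQ S.toSubmodule a)).2,
            lie_orthCentralizer_effectivePart hQ hinv hS hcomm hy (hsplit a ha), neg_zero, add_zero]
        rw [← hinv, this, map_zero, LinearMap.zero_apply] }
  have hSL : S.toSubmodule ≤ L.toSubmodule := fun s hs y hy ↦ by rw [hQ.symm]; exact (hy s hs).1
  -- The action of `x` respects the splitting of `L`, so both components of `v` commute with `x`;
  -- the effective one vanishes by injectivity, and the other is a multiple of `x`.
  have hcent : ∀ v ∈ L, ⁅x, v⁆ = 0 → ∃ κ : ℝ, v = κ • x := by
    intro v hv hxv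
    set p := orthProj Q hQ S.toSubmodule v with hp
    have hpS : p ∈ S := orthProj_mem hQ S.toSubmodule v
    have hq := hsplit v hv
    have h1 : ⁅x, p⁆ = 0 := by
      rw [← hp] at hq
      have h2 : ⁅x, p⁆ = -⁅x, v - p⁆ := by rw [lie_sub, hxv, zero_sub, neg_neg]
      have h3 := (lie_mem_effectivePart hinv hx hq).1 _ (S.lie_mem hx hpS)
      rw [← neg_neg ⁅x, v - p⁆, ← h2, map_neg, neg_eq_zero] at h3
      exact hQ.eq_zero h3
    have h2 : v - p = 0 := eq_zero_of_lie_eq_zero hQ hinv hS hcomm hx hx0 hq (by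
      rw [lie_sub, hxv, h1, sub_zero])
    rw [sub_eq_zero] at h2
    rw [h2]
    exact eq_smul_of_commute hQ hinv hS hcomm hne hx hx0 hpS h1
  have hle := le_of_rank_one hQ hinv L (hSL hx) hcent hSL hx (fun v hv ↦ S.lie_mem hx hv)
    (S.lie_mem hx hx') hxx' (by rw [← hinv, lie_self, map_zero, LinearMap.zero_apply])
  refine hne ((Submodule.eq_bot_iff _).2 fun u hu ↦ ?_)
  exact hQ.eq_zero (hu.1 u (hle hu.2))

/-- If the orthogonal projections to a simple subalgebra `S` of a commuting pair always commute, then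
`S` is an ideal. -/
theorem lie_eq_zero_of_orthogonal {x y : V} (hx : x ∈ S) (hy : ∀ w ∈ S, Q w y = 0) :
    ⁅x, y⁆ = 0 := by
  set p := orthProj Q hQ (orthCentralizer Q S) y with hp
  have hpm : p ∈ orthCentralizer Q S := orthProj_mem hQ _ y
  have h : y - p ∈ effectivePart Q S :=
    ⟨fun w hw ↦ by rw [map_sub, hy w hw, (hpm w hw).1, sub_zero],
      fun z hz ↦ apply_sub_orthProj hQ _ hz y⟩
  rw [effectivePart_eq_bot hQ hinv hS hcomm, Submodule.mem_bot, sub_eq_zero] at h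
  rw [h]
  exact (hpm x hx).2

end CommutingProjections

/-! ### From simple ideals of `𝔥` to its semisimple part. -/

section Ideals

variable {V : Type*} [LieRing V] [LieAlgebra ℝ V] [FiniteDimensional ℝ V]
  {Q : LinearMap.BilinForm ℝ V} (hQ : IsInnerProduct Q) (hinv : IsAdInvariant Q)
include hinv

/-- The complement of `S` in `𝔥` commutes with the ideal `S`. So the bracket of the `S`-components
is, up to sign, the bracket of the complementary ones, which is orthogonal to `S`. -/
theorem lie_orthProj_eq_zero_of_ideal {S 𝔥 : LieSubalgebra ℝ V} (hS : S ≤ 𝔥)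
    (hideal : ∀ a ∈ 𝔥, ∀ s ∈ S, ⁅a, s⁆ ∈ S) {x y : V}
    (hxy : ⁅orthProj Q hQ 𝔥.toSubmodule x, orthProj Q hQ 𝔥.toSubmodule y⁆ = 0) :
    ⁅orthProj Q hQ S.toSubmodule x, orthProj Q hQ S.toSubmodule y⁆ = 0 := by
  have hP : ∀ v, orthProj Q hQ S.toSubmodule (orthProj Q hQ 𝔥.toSubmodule v) =
      orthProj Q hQ S.toSubmodule v := fun v ↦ by
    rw [← sub_eq_zero, ← map_sub]
    refine orthProj_of_orthogonal hQ _ fun w hw ↦ ?_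
    rw [map_sub, apply_orthProj hQ _ (hS hw), sub_self]
  rw [← hP x, ← hP y]
  have hx := orthProj_mem hQ 𝔥.toSubmodule x
  have hy := orthProj_mem hQ 𝔥.toSubmodule y
  generalize orthProj Q hQ 𝔥.toSubmodule x = a at *
  generalize orthProj Q hQ 𝔥.toSubmodule y = b at *
  set p := orthProj Q hQ S.toSubmodule a
  set q := orthProj Q hQ S.toSubmodule b
  have hp : p ∈ S := orthProj_mem hQ S.toSubmodule a
  have hq : q ∈ S := orthProj_mem hQ S.toSubmodule b
  have hpa : ∀ w ∈ S, Q w (a - p) = 0 := fun w hw ↦ apply_sub_orthProj hQ S.toSubmodule hw a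
  have hqb : ∀ w ∈ S, Q w (b - q) = 0 := fun w hw ↦ apply_sub_orthProj hQ S.toSubmodule hw b
  have hzero : ∀ c ∈ 𝔥, (∀ w ∈ S, Q w c = 0) → ∀ s ∈ S, ⁅c, s⁆ = 0 := fun c hc hcS s hs ↦ by
    refine hQ.eq_zero ?_
    rw [hinv, hQ.symm]
    exact hcS _ (S.lie_mem hs (hideal c hc s hs))
  have h1 := hzero _ (𝔥.sub_mem hx (hS hp)) hpa
  have h2 := hzero _ (𝔥.sub_mem hy (hS hq)) hqb
  have hdec : ⁅p, q⁆ = -⁅a - p, b - q⁆ := by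
    have h3 := h1 q hq
    have h4 := h2 p hp
    rw [← lie_skew, neg_eq_zero] at h4
    rw [sub_lie] at h3
    rw [lie_sub] at h4
    rw [sub_lie, lie_sub, lie_sub, hxy, sub_eq_zero.1 h3, sub_eq_zero.1 h4]
    abel
  refine hQ.eq_zero ?_
  nth_rw 2 [hdec]
  rw [map_neg, ← hinv, ← lie_skew, h1 _ (S.lie_mem hp hq)]
  simp

theorem exists_lieIdeal_eq_map_semisimplePart {L : Type*} [LieRing L] [LieAlgebra ℝ L]
    (ι : L →ₗ⁅ℝ⁆ V) (hcomm : ∀ x y : V, ⁅x, y⁆ = 0 →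
      ⁅orthProj Q hQ ι.range.toSubmodule x, orthProj Q hQ ι.range.toSubmodule y⁆ = 0) :
    ∃ J : LieIdeal ℝ V,
      J.toSubmodule = (semisimplePart L).toSubmodule.map (ι : L →ₗ[ℝ] V) := by
  have hsimple : ∀ S : LieIdeal ℝ L, LieAlgebra.IsSimple ℝ S →
      ∀ s ∈ S, ∀ z, (∀ w ∈ ι.range, Q w z = 0) → ⁅ι s, z⁆ = 0 := by
    intro S hS s hs z hz
    let pull : ∀ I : Submodule ℝ V, (∀ s ∈ S, ∀ i ∈ I, ⁅ι s, i⁆ ∈ I) → LieIdeal ℝ S := fun I hI ↦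
      { I.comap ((ι : L →ₗ[ℝ] V).comp S.toSubmodule.subtype) with
        lie_mem := fun {x m} hm ↦ by
          change ι ⁅(x : L), (m : L)⁆ ∈ I
          rw [LieHom.map_lie]
          exact hI x x.2 _ hm }
    have hpull : ∀ I hI (x : S), x ∈ pull I hI ↔ ι x ∈ I := fun I hI x ↦ Iff.rfl
    -- Injectivity of `ι` is not needed: a simple ideal is either killed or has simple image, since
    -- ideals of the image pull back to ideals of `S`.
    by_cases hker : ∀ s ∈ S, ι s = 0
    · rw [hker s hs, zero_lie]
    let T : LieSubalgebra ℝ V := S.toLieSubalgebra.map ι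
    have hT : ∀ {s}, s ∈ S → ι s ∈ T := fun {s} h ↦ ⟨s, h, rfl⟩
    have hTS : ∀ x ∈ T, ∃ s ∈ S, ι s = x := fun x ⟨s, h, e⟩ ↦ ⟨s, h, e⟩
    have hTsimple : IsSimpleSubalgebra T := by
      refine ⟨fun I hIT hI ↦ ?_, ?_⟩
      · have hI' : ∀ s ∈ S, ∀ i ∈ I, ⁅ι s, i⁆ ∈ I := fun s hs ↦ hI _ (hT hs)
        rcases hS.eq_bot_or_eq_top (pull I hI') with h | h
        · left
          rw [Submodule.eq_bot_iff]
          intro i hi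
          obtain ⟨s, hs, rfl⟩ := hTS i (hIT hi)
          have : (⟨s, hs⟩ : S) ∈ pull I hI' := hi
          rw [h, LieSubmodule.mem_bot] at this
          exact (congrArg ι (congrArg Subtype.val this)).trans (map_zero ι)
        · right
          refine le_antisymm hIT fun x hx ↦ ?_
          obtain ⟨s, hs, rfl⟩ := hTS x hx
          exact (hpull I hI' ⟨s, hs⟩).1 (h ▸ LieSubmodule.mem_top _)
      · by_contra hab
        push Not at hab
        have hbot : ∀ s ∈ S, ∀ i ∈ (⊥ : Submodule ℝ V), ⁅ι s, i⁆ ∈ (⊥ : Submodule ℝ V) := by simp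
        rcases hS.eq_bot_or_eq_top (pull ⊥ hbot) with h | h
        · refine hS.non_abelian ⟨fun x m ↦ ?_⟩
          rw [← LieSubmodule.mem_bot (R := ℝ) (L := S), ← h, hpull ⊥ hbot, Submodule.mem_bot]
          change ι ⁅(x : L), (m : L)⁆ = 0
          rw [LieHom.map_lie]
          exact hab _ (hT x.2) _ (hT m.2)
        · refine hker fun s hs ↦ ?_
          have : (⟨s, hs⟩ : S) ∈ pull ⊥ hbot := h ▸ LieSubmodule.mem_top _
          exact (Submodule.mem_bot ℝ).1 this
    have hTh : T ≤ ι.range := fun x hx ↦ by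
      obtain ⟨s, -, rfl⟩ := hTS x hx
      exact ι.mem_range_self s
    have hTideal : ∀ a ∈ ι.range, ∀ s ∈ T, ⁅a, s⁆ ∈ T := by
      intro a ha x hx
      obtain ⟨b, rfl⟩ := (ι.mem_range _).1 ha
      obtain ⟨s, hs, rfl⟩ := hTS x hx
      rw [← LieHom.map_lie]
      exact hT (lie_mem_right ℝ L S b s hs)
    exact lie_eq_zero_of_orthogonal hQ hinv hTsimple (fun x y hxy ↦
      lie_orthProj_eq_zero_of_ideal hQ hinv hTh hTideal (hcomm x y hxy)) (hT hs)
      fun w hw ↦ hz w (hTh hw)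
  -- The elements whose image kills `𝔥^⊥` form an ideal, so it suffices to test the supremum on
  -- simple ideals.
  let K : LieIdeal ℝ L :=
    { carrier := {s | ∀ z, (∀ w ∈ ι.range, Q w z = 0) → ⁅ι s, z⁆ = 0}
      add_mem' := fun ha hb z hz ↦ by simp [ha z hz, hb z hz]
      zero_mem' := by simp
      smul_mem' := fun c a ha z hz ↦ by simp [ha z hz]
      lie_mem := fun {x m} hm z hz ↦ by
        rw [LieHom.map_lie, lie_lie, hm z hz, hm _ (hinv.lie_mem_orthogonal ι.range
          (ι.mem_range_self x) hz), lie_zero, sub_zero] }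
  have hK : semisimplePart L ≤ K := sSup_le fun S hS s hs ↦ hsimple S hS s hs
  refine ⟨{ (semisimplePart L).toSubmodule.map (ι : L →ₗ[ℝ] V) with
    lie_mem := ?_ }, rfl⟩
  rintro v _ ⟨s, hs, rfl⟩
  have hv := orthProj_mem hQ ι.range.toSubmodule v
  obtain ⟨a, ha⟩ := (ι.mem_range _).1 hv
  have hz : ⁅v - orthProj Q hQ ι.range.toSubmodule v, ι s⁆ = 0 := by
    rw [← lie_skew, hK hs _ fun w hw ↦ apply_sub_orthProj hQ ι.range.toSubmodule hw v, neg_zero]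
  rw [sub_lie, sub_eq_zero, ← ha, ← LieHom.map_lie] at hz
  change ⁅v, ι s⁆ ∈ Submodule.map (ι : L →ₗ[ℝ] V) (semisimplePart L).toSubmodule
  rw [hz]
  exact ⟨⁅a, s⁆, (semisimplePart L).lie_mem hs, rfl⟩

end Ideals

/-! ### Left-invariant fields, the Levi-Civita connection and curvature. -/

theorem IsInnerProduct.gram_pos {V : Type*} [AddCommGroup V] [Module ℝ V]
    {B : LinearMap.BilinForm ℝ V} (hB : IsInnerProduct B) {x y : V}
    (h : LinearIndependent ℝ ![x, y]) : 0 < B x x * B y y - B x y ^ 2 := by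
  have hx : x ≠ 0 := h.ne_zero 0
  rw [LinearIndependent.pair_iff] at h
  have hxx := hB.pos x hx
  have h1 := hB.pos (B x x • y - B x y • x) fun h0 ↦ hxx.ne'
    (h (-B x y) (B x x) (by rw [← h0]; module)).2
  simp only [map_sub, map_smul, LinearMap.sub_apply, LinearMap.smul_apply, smul_eq_mul,
    hB.symm y x] at h1
  exact pos_of_mul_pos_right (a := B x x) (by linarith) hxx.le

section LeftInvariantFields

variable {E : Type*} [NormedAddCommGroup E] [NormedSpace ℝ E]
  {G : Type*} [TopologicalSpace G] [ChartedSpace E G] [Group G] [LieGroup 𝓘(ℝ, E) ∞ G]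

theorem mdifferentiable_leftMul (a : G) :
    MDifferentiable 𝓘(ℝ, E) 𝓘(ℝ, E) (fun b : G ↦ a * b) :=
  (contMDiff_mul_left (I := 𝓘(ℝ, E)) (n := ∞) (a := a)).mdifferentiable (by simp)

/-- The field is the tangent map of multiplication applied to the zero vector at `g` and the
constant vector `v` at `1`, hence smooth. -/
theorem isSmoothVectorField_mulInvariantVectorField (v : GroupLieAlgebra 𝓘(ℝ, E) G) :
    IsSmoothVectorField (M := G) (mulInvariantVectorField v) := by
  let F₁ : G → TangentBundle 𝓘(ℝ, E) G × TangentBundle 𝓘(ℝ, E) G :=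
    fun g ↦ (Bundle.TotalSpace.mk' E g 0, Bundle.TotalSpace.mk' E 1 v)
  have S₁ : ContMDiff 𝓘(ℝ, E) (𝓘(ℝ, E).tangent.prod 𝓘(ℝ, E).tangent) ∞ F₁ :=
    (Bundle.contMDiff_zeroSection _ _).prodMk contMDiff_const
  have S₂ := contMDiff_equivTangentBundleProd_symm (I := 𝓘(ℝ, E)) (M := G) (I' := 𝓘(ℝ, E))
    (M' := G) (n := ∞)
  have S₃ := ContMDiff.contMDiff_tangentMap (m := ∞) (contMDiff_mul 𝓘(ℝ, E) (G := G) ∞) (by simp)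
  let S := (S₃.comp S₂).comp S₁
  unfold IsSmoothVectorField
  convert! S with g
  · simp [F₁]
  · simp only [Function.comp_apply, tangentMap, F₁]
    rw [mfderiv_prod_eq_add_apply ((contMDiff_mul 𝓘(ℝ, E) (G := G) ∞).mdifferentiableAt (by simp))]
    exact ((congrArg₂ (· + ·) (map_zero _) rfl).trans (zero_add _)).symm

theorem translateToOne_mulInvariantVectorField (a : G) (v : GroupLieAlgebra 𝓘(ℝ, E) G) :
    translateToOne a (mulInvariantVectorField v a) = v := by
  have h := mfderiv_comp (I := 𝓘(ℝ, E)) (I' := 𝓘(ℝ, E)) (I'' := 𝓘(ℝ, E)) (1 : G)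
    (mdifferentiable_leftMul a⁻¹ (a * 1)) (mdifferentiable_leftMul a 1)
  have hid : (fun b : G ↦ a⁻¹ * b) ∘ (fun b ↦ a * b) = id := by ext b; simp
  rw [hid, mfderiv_id] at h
  have h2 := congrArg (fun f ↦ f v) h
  refine Eq.trans ?_ h2.symm
  -- The base points `a * 1` and `a` differ definitionally; the derivative is transported between
  -- them as a map on the model space.
  have h3 : ∀ b : G, b = a → ∀ z : E, (mfderiv 𝓘(ℝ, E) 𝓘(ℝ, E) (fun b : G ↦ a⁻¹ * b) a : E → E) z =
      (mfderiv 𝓘(ℝ, E) 𝓘(ℝ, E) (fun b : G ↦ a⁻¹ * b) b : E → E) z := by rintro _ rfl z; rfl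
  exact h3 (a * 1) (mul_one a) _

variable [FiniteDimensional ℝ E]

theorem leftInvariantMetric_inner (B : LinearMap.BilinForm ℝ (GroupLieAlgebra 𝓘(ℝ, E) G))
    (hB : IsInnerProduct B) (a : G) (u v : TangentSpace 𝓘(ℝ, E) a) :
    (leftInvariantMetric B hB).inner a u v = B (translateToOne a u) (translateToOne a v) := rfl

/-- The metric is constant on left-invariant fields, so at each point the translated connection
satisfies the algebraic identities. Koszul shows that it does not depend on the point. -/
theorem exists_isLeviCivitaProduct {B : LinearMap.BilinForm ℝ (GroupLieAlgebra 𝓘(ℝ, E) G)}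
    (hB : IsInnerProduct B) {nabla : AffineConnection E G}
    (h : IsLeviCivita (leftInvariantMetric B hB) nabla) :
    ∃ n : GroupLieAlgebra 𝓘(ℝ, E) G → GroupLieAlgebra 𝓘(ℝ, E) G → GroupLieAlgebra 𝓘(ℝ, E) G,
      IsLeviCivitaProduct B n ∧ ∀ x y : GroupLieAlgebra 𝓘(ℝ, E) G,
        nabla.along (mulInvariantVectorField x) (mulInvariantVectorField y) =
          mulInvariantVectorField (n x y) := by
  let n : G → GroupLieAlgebra 𝓘(ℝ, E) G → GroupLieAlgebra 𝓘(ℝ, E) G →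
      GroupLieAlgebra 𝓘(ℝ, E) G := fun p x y ↦
    translateToOne p (nabla.along (mulInvariantVectorField x) (mulInvariantVectorField y) p)
  have hn : ∀ p, IsLeviCivitaProduct B (n p) := by
    intro p
    refine ⟨fun a b ↦ ?_, fun a b c ↦ ?_⟩
    · have h1 := congrFun (h.torsion_free _ _ (isSmoothVectorField_mulInvariantVectorField a)
        (isSmoothVectorField_mulInvariantVectorField b)) p
      rw [← mulInvariantVector_mlieBracket] at h1
      have h2 := congrArg (translateToOne p) h1
      rw [translateToOne_mulInvariantVectorField] at h2
      rw [GroupLieAlgebra.bracket_def, ← h2]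
      exact (map_sub (translateToOne (E := E) p) _ _).symm
    · have h1 := h.metric_compatible _ _ _ (isSmoothVectorField_mulInvariantVectorField a)
        (isSmoothVectorField_mulInvariantVectorField b)
        (isSmoothVectorField_mulInvariantVectorField c) p
      simp only [leftInvariantMetric_inner, translateToOne_mulInvariantVectorField] at h1
      refine h1.symm.trans ?_
      rw [mvfderiv_const]
      rfl
  refine ⟨n 1, hn 1, fun x y ↦ funext fun p ↦ translateToOne_injective p ?_⟩
  rw [translateToOne_mulInvariantVectorField]
  refine hB.ext fun z ↦ ?_
  have h1 := (hn p).koszul hB x y z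
  have h2 := (hn 1).koszul hB x y z
  exact mul_left_cancel₀ two_ne_zero (h1.trans h2.symm)

theorem curvature_nonneg_of_hasNonnegSectionalCurvature
    {B : LinearMap.BilinForm ℝ (GroupLieAlgebra 𝓘(ℝ, E) G)} (hB : IsInnerProduct B)
    (h : HasNonnegSectionalCurvature (leftInvariantMetric B hB)) :
    ∃ n : GroupLieAlgebra 𝓘(ℝ, E) G → GroupLieAlgebra 𝓘(ℝ, E) G → GroupLieAlgebra 𝓘(ℝ, E) G,
      IsLeviCivitaProduct B n ∧ ∀ x y, LinearIndependent ℝ ![x, y] →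
        0 ≤ B (n x (n y y) - n y (n x y) - n ⁅x, y⁆ y) x := by
  obtain ⟨nabla, hn, hK⟩ := h
  obtain ⟨n, hnB, hn'⟩ := exists_isLeviCivitaProduct hB hn
  refine ⟨n, hnB, fun x y hxy ↦ ?_⟩
  have htr := translateToOne_mulInvariantVectorField (E := E) (1 : G)
  have hone : ∀ v : GroupLieAlgebra 𝓘(ℝ, E) G, mulInvariantVectorField v (1 : G) = v := by
    intro v
    have h1 : ∀ f : G → G, f = id → (mfderiv 𝓘(ℝ, E) 𝓘(ℝ, E) f 1 : E → E) v = v := by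
      rintro _ rfl
      rw [mfderiv_id]
      rfl
    exact h1 _ (funext one_mul)
  have h1 := hK _ _ (isSmoothVectorField_mulInvariantVectorField x)
    (isSmoothVectorField_mulInvariantVectorField y) 1 (by rwa [hone, hone])
  have hcurv : nabla.curvature (mulInvariantVectorField x) (mulInvariantVectorField y)
      (mulInvariantVectorField y) =
      mulInvariantVectorField (n x (n y y) - n y (n x y) - n ⁅x, y⁆ y) := by
    rw [AffineConnection.curvature, ← mulInvariantVector_mlieBracket,
      ← GroupLieAlgebra.bracket_def, hn', hn', hn', hn', hn']
    funext p
    have hs : ∀ a b : GroupLieAlgebra 𝓘(ℝ, E) G, mulInvariantVectorField (a - b) p =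
        mulInvariantVectorField a p - mulInvariantVectorField b p := fun a b ↦
      map_sub (mfderiv 𝓘(ℝ, E) 𝓘(ℝ, E) (fun b : G ↦ p * b) 1) a b
    rw [hs, hs]
    rfl
  rw [sectionalCurvature, hcurv] at h1
  simp only [leftInvariantMetric_inner, htr] at h1
  by_contra hneg
  rw [not_le] at hneg
  exact h1.not_gt (div_neg_of_neg_of_pos hneg (hB.gram_pos hxy))

end LeftInvariantFields

/-! ### Multiplication and the Lie bracket in the chart at `1`. -/

section ChartMul

open Filter Topology

variable {E : Type*} [NormedAddCommGroup E] [NormedSpace ℝ E]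
  (G : Type*) [TopologicalSpace G] [ChartedSpace E G] [Group G]

/-- The multiplication of `G`, read in the chart at `1`. -/
noncomputable def chartMul (p : E × E) : E :=
  extChartAt 𝓘(ℝ, E) (1 : G)
    ((extChartAt 𝓘(ℝ, E) (1 : G)).symm p.1 * (extChartAt 𝓘(ℝ, E) (1 : G)).symm p.2)

/-- The unit of `G`, read in the chart at `1`. -/
noncomputable def chartOne : E := extChartAt 𝓘(ℝ, E) (1 : G) 1

/-- The left-invariant vector field determined by `v`, read in the chart at `1`. -/
noncomputable def chartField (v : E) (x : E) : E := fderiv ℝ (chartMul G) (x, chartOne G) (0, v)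

theorem symm_chartOne : (extChartAt 𝓘(ℝ, E) (1 : G)).symm (chartOne G) = 1 :=
  extChartAt_to_inv (I := 𝓘(ℝ, E)) (1 : G)

theorem target_mem_nhds_chartOne :
    (extChartAt 𝓘(ℝ, E) (1 : G)).target ∈ 𝓝 (chartOne G : E) :=
  extChartAt_target_mem_nhds (I := 𝓘(ℝ, E)) (1 : G)

theorem chartMul_one_left : ∀ᶠ x in 𝓝 (chartOne G : E), chartMul G (chartOne G, x) = x := by
  filter_upwards [target_mem_nhds_chartOne G] with x hx
  rw [chartMul, symm_chartOne, one_mul, PartialEquiv.right_inv _ hx]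

theorem chartMul_one_right : ∀ᶠ x in 𝓝 (chartOne G : E), chartMul G (x, chartOne G) = x := by
  filter_upwards [target_mem_nhds_chartOne G] with x hx
  rw [chartMul, symm_chartOne, mul_one, PartialEquiv.right_inv _ hx]

variable [LieGroup 𝓘(ℝ, E) ∞ G]

theorem contMDiffAt_symm {x : E} (hx : x ∈ (extChartAt 𝓘(ℝ, E) (1 : G)).target) :
    ContMDiffAt 𝓘(ℝ, E) 𝓘(ℝ, E) ∞ (extChartAt 𝓘(ℝ, E) (1 : G)).symm x := by
  exact (contMDiffOn_extChartAt_symm (I := 𝓘(ℝ, E)) (n := ∞) (1 : G)).contMDiffAt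
    ((isOpen_extChartAt_target (I := 𝓘(ℝ, E)) (1 : G)).mem_nhds hx)

theorem contMDiffAt_symm_chartOne :
    ContMDiffAt 𝓘(ℝ, E) 𝓘(ℝ, E) ∞ (extChartAt 𝓘(ℝ, E) (1 : G)).symm (chartOne G) :=
  contMDiffAt_symm G (mem_extChartAt_target (I := 𝓘(ℝ, E)) (1 : G))

theorem contDiffAt_chartMul : ContDiffAt ℝ ∞ (chartMul G) ((chartOne G, chartOne G) : E × E) := by
  have h1 : ContMDiffAt (𝓘(ℝ, E).prod 𝓘(ℝ, E)) 𝓘(ℝ, E) ∞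
      (fun p : E × E ↦ (extChartAt 𝓘(ℝ, E) (1 : G)).symm p.1) (chartOne G, chartOne G) :=
    (contMDiffAt_symm_chartOne G).comp (chartOne G, chartOne G) contMDiffAt_fst
  have h2 : ContMDiffAt (𝓘(ℝ, E).prod 𝓘(ℝ, E)) 𝓘(ℝ, E) ∞
      (fun p : E × E ↦ (extChartAt 𝓘(ℝ, E) (1 : G)).symm p.2) (chartOne G, chartOne G) :=
    (contMDiffAt_symm_chartOne G).comp (chartOne G, chartOne G) contMDiffAt_snd
  have h4 : ContMDiffAt 𝓘(ℝ, E) 𝓘(ℝ, E) ∞ (extChartAt 𝓘(ℝ, E) (1 : G))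
      ((extChartAt 𝓘(ℝ, E) (1 : G)).symm (chartOne G) *
        (extChartAt 𝓘(ℝ, E) (1 : G)).symm (chartOne G)) := by
    rw [symm_chartOne, mul_one]
    exact contMDiffAt_extChartAt
  have h5 : ContMDiffAt (𝓘(ℝ, E).prod 𝓘(ℝ, E)) 𝓘(ℝ, E) ∞ (chartMul G)
      ((chartOne G, chartOne G) : E × E) :=
    ContMDiffAt.comp (I' := 𝓘(ℝ, E)) (chartOne G, chartOne G) h4 (h1.mul h2)
  rwa [← modelWithCornersSelf_prod, chartedSpaceSelf_prod, contMDiffAt_iff_contDiffAt] at h5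

theorem eventually_differentiableAt_chartMul :
    ∀ᶠ p in 𝓝 ((chartOne G, chartOne G) : E × E), DifferentiableAt ℝ (chartMul G) p := by
  filter_upwards [((contDiffAt_chartMul G).of_le (m := 1) (by norm_cast)).eventually (by simp)]
    with p hp
  exact hp.differentiableAt (by simp)

theorem mfderiv_symm_chartOne (v : E) :
    mfderiv 𝓘(ℝ, E) 𝓘(ℝ, E) (extChartAt 𝓘(ℝ, E) (1 : G)).symm (chartOne G) v = v := by
  have h := mfderivWithin_range_extChartAt_symm (I := 𝓘(ℝ, E)) (x := (1 : G))
  rw [ModelWithCorners.range_eq_univ, mfderivWithin_univ] at h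
  exact congrArg (fun f : E →L[ℝ] E ↦ f v) h

/-- The left-invariant field at `g` is the derivative of `b ↦ g * b` at `1`; in the chart this is
the partial derivative of `chartMul` in its second variable. -/
theorem mpullbackWithin_symm_mulInvariantVectorField (v : GroupLieAlgebra 𝓘(ℝ, E) G) :
    ∀ᶠ x in 𝓝 (chartOne G : E), VectorField.mpullbackWithin 𝓘(ℝ, E) 𝓘(ℝ, E)
      (extChartAt 𝓘(ℝ, E) (1 : G)).symm (mulInvariantVectorField v) (Set.range 𝓘(ℝ, E)) x =
      chartField (E := E) G v x := by
  filter_upwards [target_mem_nhds_chartOne G,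
    Tendsto.eventually (f := fun x : E ↦ (x, (chartOne G : E)))
      (ContinuousAt.tendsto (by fun_prop)) (eventually_differentiableAt_chartMul G)] with x hx hd
  have hx' : (extChartAt 𝓘(ℝ, E) (1 : G)).symm x ∈ (chartAt E (1 : G)).source := by
    rw [← extChartAt_source (I := 𝓘(ℝ, E))]
    exact PartialEquiv.map_target _ hx
  have h1 : (mfderiv[Set.range 𝓘(ℝ, E)] (extChartAt 𝓘(ℝ, E) (1 : G)).symm x).inverse =
      mfderiv 𝓘(ℝ, E) 𝓘(ℝ, E) (extChartAt 𝓘(ℝ, E) (1 : G))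
        ((extChartAt 𝓘(ℝ, E) (1 : G)).symm x) :=
    ContinuousLinearMap.inverse_eq (mfderivWithin_extChartAt_symm_comp_mfderiv_extChartAt hx)
      (mfderiv_extChartAt_comp_mfderivWithin_extChartAt_symm hx)
  rw [VectorField.mpullbackWithin_apply, h1]
  set g := (extChartAt 𝓘(ℝ, E) (1 : G)).symm x with hg
  have h2 : chartField (E := E) G v x =
      fderiv ℝ (fun y : E ↦ chartMul G (x, y)) (chartOne G) v := by
    have h3 : HasFDerivAt (fun y : E ↦ ((x, y) : E × E)) (ContinuousLinearMap.inr ℝ E E)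
      (chartOne G) := hasFDerivAt_prodMk_right x _
    have h4 := (hd.hasFDerivAt.comp (chartOne G) h3).fderiv
    exact (congrArg (fun f : E →L[ℝ] E ↦ f v) h4).symm
  have hd1 : MDifferentiableAt 𝓘(ℝ, E) 𝓘(ℝ, E) (extChartAt 𝓘(ℝ, E) (1 : G)) g :=
    mdifferentiableAt_extChartAt hx'
  have hd2 := (mdifferentiable_leftMul (E := E) g 1)
  have hd3 := (contMDiffAt_symm_chartOne (E := E) G).mdifferentiableAt (by simp)
  have h5 : (fun y : E ↦ chartMul G (x, y)) =
      (extChartAt 𝓘(ℝ, E) (1 : G) ∘ (fun b ↦ g * b)) ∘ (extChartAt 𝓘(ℝ, E) (1 : G)).symm := rfl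
  rw [h2, ← mfderiv_eq_fderiv, h5]
  have hd4 : MDifferentiableAt 𝓘(ℝ, E) 𝓘(ℝ, E) (extChartAt 𝓘(ℝ, E) (1 : G) ∘ (fun b ↦ g * b)) 1 :=
    MDifferentiableAt.comp (I' := 𝓘(ℝ, E)) 1 (by rwa [mul_one]) hd2
  refine Eq.trans ?_ (mfderiv_comp_apply_of_eq (chartOne G) hd4 hd3 (symm_chartOne G) v).symm
  refine (mfderiv_comp_apply_of_eq 1 hd1 hd2 (mul_one g) v).symm.trans ?_
  exact congrArg (fun z : E ↦ (mfderiv 𝓘(ℝ, E) 𝓘(ℝ, E)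
    (extChartAt 𝓘(ℝ, E) (1 : G) ∘ (fun b ↦ g * b)) 1 : E → E) z) (mfderiv_symm_chartOne (E := E) G v).symm

theorem chartField_chartOne (v : E) : chartField G v (chartOne G) = v := by
  have h1 := (eventually_differentiableAt_chartMul (E := E) G).self_of_nhds
  have h3 : HasFDerivAt (fun y : E ↦ ((chartOne G, y) : E × E)) (ContinuousLinearMap.inr ℝ E E)
    (chartOne G) := hasFDerivAt_prodMk_right _ _
  have h4 := h1.hasFDerivAt.comp (chartOne G) h3
  have h5 : HasFDerivAt (fun y : E ↦ chartMul G (chartOne G, y)) (ContinuousLinearMap.id ℝ E)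
    (chartOne G) := (hasFDerivAt_id _).congr_of_eventuallyEq (chartMul_one_left G)
  exact congrArg (fun f : E →L[ℝ] E ↦ f v) (h4.unique h5)

theorem differentiableAt_fderiv_chartMul :
    DifferentiableAt ℝ (fderiv ℝ (chartMul G)) ((chartOne G, chartOne G) : E × E) :=
  ((contDiffAt_chartMul G).fderiv_right (m := 1) (by norm_cast)).differentiableAt (by simp)

theorem hasFDerivAt_chartField (v : E) : HasFDerivAt (chartField G v)
    (((fderiv ℝ (fderiv ℝ (chartMul G)) ((chartOne G, chartOne G) : E × E)).comp
      (ContinuousLinearMap.inl ℝ E E)).flip (0, v)) (chartOne G) := by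
  have h3 : HasFDerivAt (fun y : E ↦ ((y, chartOne G) : E × E)) (ContinuousLinearMap.inl ℝ E E)
    (chartOne G) := hasFDerivAt_prodMk_left _ _
  have h4 := HasFDerivAt.comp (g := fderiv ℝ (chartMul G))
    (f := fun y : E ↦ ((y, chartOne G) : E × E)) (chartOne G)
    (differentiableAt_fderiv_chartMul (E := E) G).hasFDerivAt h3
  have h5 := h4.clm_apply (hasFDerivAt_const (((0 : E), v) : E × E) (chartOne G : E))
  exact HasFDerivAt.congr_fderiv (f := chartField G v) h5 (by ext; simp)

theorem bracket_eq_lieBracket_chartField [CompleteSpace E] (v w : GroupLieAlgebra 𝓘(ℝ, E) G) :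
    ⁅v, w⁆ = VectorField.lieBracket ℝ (chartField (E := E) G v) (chartField (E := E) G w)
      (chartOne G) := by
  rw [GroupLieAlgebra.bracket_def, VectorField.mlieBracket, VectorField.mlieBracketWithin_apply,
    mfderiv_extChartAt_self]
  have h : ∀ u : GroupLieAlgebra 𝓘(ℝ, E) G, VectorField.mpullbackWithin 𝓘(ℝ, E) 𝓘(ℝ, E)
      (extChartAt 𝓘(ℝ, E) (1 : G)).symm (mulInvariantVectorField u) (Set.range 𝓘(ℝ, E))
        =ᶠ[𝓝 (chartOne G : E)] chartField (E := E) G u :=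
    fun u ↦ mpullbackWithin_symm_mulInvariantVectorField G u
  have h2 := Filter.EventuallyEq.lieBracket_vectorField_eq (𝕜 := ℝ) (h v) (h w)
  have hid (z : E) : (ContinuousLinearMap.id ℝ E).inverse z = z := by
    rw [ContinuousLinearMap.inverse_id, ContinuousLinearMap.id_apply]
  refine (hid _).trans ?_
  rw [Set.preimage_univ, Set.univ_inter, ModelWithCorners.range_eq_univ]
  rw [ModelWithCorners.range_eq_univ] at h2
  exact (congrFun (VectorField.lieBracketWithin_univ (𝕜 := ℝ) (E := E)) _).trans h2

theorem bracket_eq_fderiv_fderiv_chartMul [CompleteSpace E] (v w : GroupLieAlgebra 𝓘(ℝ, E) G) :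
    ⁅v, w⁆ = fderiv ℝ (chartField (E := E) G w) (chartOne G) v
      - fderiv ℝ (chartField (E := E) G v) (chartOne G) w := by
  have h (u : E) : chartField G u (chartOne G) = u := chartField_chartOne G u
  refine (bracket_eq_lieBracket_chartField G v w).trans ?_
  exact congrArg₂ (fun a b ↦ fderiv ℝ (chartField (E := E) G w) (chartOne G) a
    - fderiv ℝ (chartField (E := E) G v) (chartOne G) b) (h v) (h w)

end ChartMul

/-! ### Homomorphisms of Lie groups in charts. -/

section ChartMap

open Filter Topology

variable {E : Type*} [NormedAddCommGroup E] [NormedSpace ℝ E]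
  {G : Type*} [TopologicalSpace G] [ChartedSpace E G] [Group G]
  {F : Type*} [NormedAddCommGroup F] [NormedSpace ℝ F]
  {K : Type*} [TopologicalSpace K] [ChartedSpace F K] [Group K]

/-- A homomorphism of Lie groups, read in the charts at the units. -/
noncomputable def chartMap (f : K →* G) (x : F) : E :=
  extChartAt 𝓘(ℝ, E) (1 : G) (f ((extChartAt 𝓘(ℝ, F) (1 : K)).symm x))

theorem chartMap_chartOne (f : K →* G) : chartMap f (chartOne K : F) = (chartOne G : E) := by
  rw [chartMap, symm_chartOne, map_one, chartOne]

theorem tendsto_prodMk_chartOne :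
    Tendsto (fun a : F ↦ (a, (chartOne K : F))) (𝓝 (chartOne K)) (𝓝 (chartOne K, chartOne K)) :=
  ContinuousAt.tendsto (by fun_prop)

/-- The differential at `1` of a homomorphism of Lie groups. -/
noncomputable def chartDeriv (f : K →* G) (v : GroupLieAlgebra 𝓘(ℝ, F) K) :
    GroupLieAlgebra 𝓘(ℝ, E) G :=
  fderiv ℝ (chartMap f : F → E) (chartOne K) v

variable [LieGroup 𝓘(ℝ, F) ∞ K]

theorem contDiffAt_chartMap {f : K →* G} (hf : ContMDiff 𝓘(ℝ, F) 𝓘(ℝ, E) ∞ f) :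
    ContDiffAt ℝ ∞ (chartMap f : F → E) (chartOne K) := by
  have h4 : ContMDiffAt 𝓘(ℝ, E) 𝓘(ℝ, E) ∞ (extChartAt 𝓘(ℝ, E) (1 : G))
      (f ((extChartAt 𝓘(ℝ, F) (1 : K)).symm (chartOne K))) := by
    rw [symm_chartOne, map_one]
    exact contMDiffAt_extChartAt
  have h5 : ContMDiffAt 𝓘(ℝ, F) 𝓘(ℝ, E) ∞ (chartMap f : F → E) (chartOne K) :=
    ContMDiffAt.comp (I' := 𝓘(ℝ, E)) (chartOne K) h4
      (ContMDiffAt.comp (I' := 𝓘(ℝ, F)) (chartOne K) hf.contMDiffAt (contMDiffAt_symm_chartOne K))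
  exact h5.contDiffAt

theorem chartMap_chartMul {f : K →* G} (hf : Continuous f) :
    ∀ᶠ p in 𝓝 ((chartOne K, chartOne K) : F × F),
      (chartMap f (chartMul K p) : E) = chartMul G (chartMap f p.1, chartMap f p.2) := by
  have hc : ContinuousAt (extChartAt 𝓘(ℝ, F) (1 : K)).symm (chartOne K : F) :=
    (contMDiffAt_symm_chartOne K).continuousAt
  have h1 : ContinuousAt (fun p : F × F ↦ (extChartAt 𝓘(ℝ, F) (1 : K)).symm p.1)
      (chartOne K, chartOne K) := hc.comp (f := Prod.fst) continuousAt_fst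
  have h2 : ContinuousAt (fun p : F × F ↦ (extChartAt 𝓘(ℝ, F) (1 : K)).symm p.2)
      (chartOne K, chartOne K) := hc.comp (f := Prod.snd) continuousAt_snd
  have h3 : ContinuousAt (fun p : F × F ↦ (extChartAt 𝓘(ℝ, F) (1 : K)).symm p.1 *
      (extChartAt 𝓘(ℝ, F) (1 : K)).symm p.2) (chartOne K, chartOne K) :=
    ContinuousAt.comp (g := fun q : K × K ↦ q.1 * q.2)
      (contMDiff_mul 𝓘(ℝ, F) (G := K) ∞).continuous.continuousAt (h1.prodMk h2)
  have hK : (extChartAt 𝓘(ℝ, F) (1 : K)).source ∈ 𝓝 (1 : K) := extChartAt_source_mem_nhds _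
  have hG : (extChartAt 𝓘(ℝ, E) (1 : G)).source ∈ 𝓝 (1 : G) := extChartAt_source_mem_nhds _
  have hG' : f ⁻¹' (extChartAt 𝓘(ℝ, E) (1 : G)).source ∈ 𝓝 (1 : K) :=
    hf.continuousAt.preimage_mem_nhds (by rwa [map_one])
  filter_upwards [h3.preimage_mem_nhds (by simpa only [symm_chartOne, mul_one] using hK),
    h1.preimage_mem_nhds (by simpa only [symm_chartOne] using hG'),
    h2.preimage_mem_nhds (by simpa only [symm_chartOne] using hG')] with p hp1 hp2 hp3
  simp only [chartMap, chartMul]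
  rw [PartialEquiv.left_inv _ hp1, PartialEquiv.left_inv _ hp2, PartialEquiv.left_inv _ hp3,
    map_mul]

variable [LieGroup 𝓘(ℝ, E) ∞ G]

/-- Differentiating `f (a b) = f a * f b` in `b` at the unit shows that corresponding left-invariant
fields are `f`-related. -/
theorem fderiv_chartMap_chartField {f : K →* G} (hf : ContMDiff 𝓘(ℝ, F) 𝓘(ℝ, E) ∞ f) (w : F) :
    ∀ᶠ a in 𝓝 (chartOne K : F), fderiv ℝ (chartMap f : F → E) a (chartField K w a) =
      chartField G (fderiv ℝ (chartMap f : F → E) (chartOne K) w) (chartMap f a) := by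
  have hs := contDiffAt_chartMap (E := E) (F := F) hf
  have hF : ∀ᶠ a in 𝓝 (chartOne K : F), DifferentiableAt ℝ (chartMap f : F → E) a := by
    filter_upwards [(hs.of_le (m := 1) (by norm_cast)).eventually (by simp)] with a ha
    exact ha.differentiableAt (by simp)
  have hG : Tendsto (fun a : F ↦ ((chartMap f a : E), (chartOne G : E))) (𝓝 (chartOne K))
      (𝓝 (chartOne G, chartOne G)) := by
    have h := hs.continuousAt.tendsto
    rw [chartMap_chartOne] at h
    exact h.prodMk_nhds tendsto_const_nhds
  filter_upwards [chartMul_one_right K, hF,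
    tendsto_prodMk_chartOne.eventually (eventually_differentiableAt_chartMul K),
    tendsto_prodMk_chartOne.eventually (chartMap_chartMul (E := E) hf.continuous).eventually_nhds,
    hG.eventually (eventually_differentiableAt_chartMul G)] with a ha hFa hKa heq hGa
  have h1 : HasFDerivAt (fun b : F ↦ ((a, b) : F × F)) (ContinuousLinearMap.inr ℝ F F)
      (chartOne K) := hasFDerivAt_prodMk_right _ _
  have h2 : HasFDerivAt (fun b : F ↦ chartMul K (a, b))
      ((fderiv ℝ (chartMul K) (a, chartOne K)).comp (ContinuousLinearMap.inr ℝ F F))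
      (chartOne K) := HasFDerivAt.comp (g := chartMul K) _ hKa.hasFDerivAt h1
  have h3 : HasFDerivAt (fun b : F ↦ (chartMap f (chartMul K (a, b)) : E))
      ((fderiv ℝ (chartMap f : F → E) a).comp
        ((fderiv ℝ (chartMul K) (a, chartOne K)).comp (ContinuousLinearMap.inr ℝ F F)))
      (chartOne K) := by
    refine HasFDerivAt.comp (g := (chartMap f : F → E)) _ ?_ h2
    rw [ha]
    exact hFa.hasFDerivAt
  have h4 : HasFDerivAt (fun b : F ↦ ((chartMap f a, chartMap f b) : E × E))
      ((ContinuousLinearMap.inr ℝ E E).comp (fderiv ℝ (chartMap f : F → E) (chartOne K)))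
      (chartOne K) :=
    HasFDerivAt.comp (g := fun y : E ↦ ((chartMap f a, y) : E × E)) _
      (hasFDerivAt_prodMk_right _ _) (hs.differentiableAt (by simp)).hasFDerivAt
  have h5 : HasFDerivAt (fun b : F ↦ chartMul G ((chartMap f a, chartMap f b) : E × E))
      ((fderiv ℝ (chartMul G) ((chartMap f a, chartOne G) : E × E)).comp
        ((ContinuousLinearMap.inr ℝ E E).comp (fderiv ℝ (chartMap f : F → E) (chartOne K))))
      (chartOne K) := by
    refine HasFDerivAt.comp (g := chartMul G) _ ?_ h4
    rw [chartMap_chartOne]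
    exact hGa.hasFDerivAt
  have h6 : (fun b : F ↦ (chartMap f (chartMul K (a, b)) : E)) =ᶠ[𝓝 (chartOne K)]
      fun b ↦ chartMul G ((chartMap f a, chartMap f b) : E × E) :=
    (Tendsto.eventually (f := fun b : F ↦ ((a, b) : F × F)) (ContinuousAt.tendsto (by fun_prop))
      heq)
  have h7 := congrArg (fun T : F →L[ℝ] E ↦ T w) ((h5.congr_of_eventuallyEq h6).unique h3).symm
  exact h7

theorem chartDeriv_lie [CompleteSpace E] [CompleteSpace F]
    {f : K →* G} (hf : ContMDiff 𝓘(ℝ, F) 𝓘(ℝ, E) ∞ f) (v w : GroupLieAlgebra 𝓘(ℝ, F) K) :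
    chartDeriv (E := E) f ⁅v, w⁆ = ⁅chartDeriv (E := E) f v, chartDeriv (E := E) f w⁆ := by
  have hs := contDiffAt_chartMap (E := E) (F := F) hf
  have hd := (hs.differentiableAt (by simp)).hasFDerivAt
  -- Relatedness holds near the unit, not just at it, and so may be differentiated once more.
  have key (u z : F) : fderiv ℝ (fun x ↦ fderiv ℝ (chartMap f : F → E) x (chartField K u x))
      (chartOne K) z = fderiv ℝ (chartField G (fderiv ℝ (chartMap f : F → E) (chartOne K) u))
        (chartOne G) (fderiv ℝ (chartMap f : F → E) (chartOne K) z) := by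
    have h1 := Filter.EventuallyEq.fderiv_eq (𝕜 := ℝ) (fderiv_chartMap_chartField (E := E) hf u)
    have h2 := hasFDerivAt_chartField G (fderiv ℝ (chartMap f : F → E) (chartOne K) u)
    rw [h2.fderiv, h1]
    rw [← chartMap_chartOne (F := F) f] at h2
    have h3 := (HasFDerivAt.comp (g := chartField G _) _ h2 hd).fderiv
    rw [chartMap_chartOne] at h3
    exact congrArg (fun T : F →L[ℝ] E ↦ T z) h3
  have hb (v w : F) := VectorField.fderiv_apply_lieBracket (𝕜 := ℝ) hs (n := ∞)
    (by rw [minSmoothness_of_isRCLikeNormedField]; norm_cast)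
    (hasFDerivAt_chartField (E := F) K w).differentiableAt (hasFDerivAt_chartField (E := F) K v).differentiableAt
  simp only [chartField_chartOne, key] at hb
  have h1 := bracket_eq_lieBracket_chartField K v w
  have h2 := bracket_eq_fderiv_fderiv_chartMul G (chartDeriv (E := E) f v) (chartDeriv f w)
  exact (congrArg (chartDeriv (E := E) f) h1).trans ((hb v w).trans h2.symm)

end ChartMap

/-! ### The inclusion of the Lie algebra of the subgroup. -/

section Subgroup

variable {E : Type*} [NormedAddCommGroup E] [NormedSpace ℝ E]
  {G : Type*} [TopologicalSpace G] [ChartedSpace E G] [Group G]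
  {F : Type*} [NormedAddCommGroup F] [NormedSpace ℝ F]
  (H : Subgroup G) [ChartedSpace F H]

theorem lieAlgebraInclusion_eq_chartDeriv
    (hH : ContMDiff 𝓘(ℝ, F) 𝓘(ℝ, E) ∞ (Subtype.val : H → G)) (v : GroupLieAlgebra 𝓘(ℝ, F) H) :
    lieAlgebraInclusion (E := E) H v = chartDeriv H.subtype v := by
  have h : mfderiv 𝓘(ℝ, F) 𝓘(ℝ, E) (Subtype.val : H → G) 1 =
      fderiv ℝ (chartMap H.subtype : F → E) (chartOne H) := by
    rw [(hH.mdifferentiableAt (by simp)).mfderiv, ModelWithCorners.range_eq_univ,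
      fderivWithin_univ]
    rfl
  exact congrArg (fun T : F →L[ℝ] E ↦ T v) h

variable [LieGroup 𝓘(ℝ, E) ∞ G] [LieGroup 𝓘(ℝ, F) ∞ H] [CompleteSpace E] [CompleteSpace F]

theorem lieAlgebraInclusion_lie (hH : ContMDiff 𝓘(ℝ, F) 𝓘(ℝ, E) ∞ (Subtype.val : H → G))
    (v w : GroupLieAlgebra 𝓘(ℝ, F) H) :
    lieAlgebraInclusion (E := E) H ⁅v, w⁆ =
      ⁅lieAlgebraInclusion (E := E) H v, lieAlgebraInclusion (E := E) H w⁆ := by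
  simp only [lieAlgebraInclusion_eq_chartDeriv H hH]
  exact chartDeriv_lie (f := H.subtype) hH v w

end Subgroup

/-! ### Conjugation in the chart, and `ad` as the derivative of `Ad`. -/

section ChartConj

open Filter Topology

variable {E : Type*} [NormedAddCommGroup E] [NormedSpace ℝ E]
  (G : Type*) [TopologicalSpace G] [ChartedSpace E G] [Group G]

/-- Conjugation in `G`, read in the chart at `1`. -/
noncomputable def chartConj (p : E × E) : E :=
  extChartAt 𝓘(ℝ, E) (1 : G) ((extChartAt 𝓘(ℝ, E) (1 : G)).symm p.1 *
    (extChartAt 𝓘(ℝ, E) (1 : G)).symm p.2 * ((extChartAt 𝓘(ℝ, E) (1 : G)).symm p.1)⁻¹)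

/-- The adjoint action on `x`, read in the chart at `1`. -/
noncomputable def chartAd (x : E) (a : E) : E := fderiv ℝ (chartConj G) (a, chartOne G) (0, x)

theorem chartConj_chartOne (a : E) : chartConj G (a, chartOne G) = chartOne G := by
  rw [chartConj, symm_chartOne, mul_one, mul_inv_cancel, chartOne]

theorem chartConj_one_left : ∀ᶠ y in 𝓝 (chartOne G : E), chartConj G (chartOne G, y) = y := by
  filter_upwards [target_mem_nhds_chartOne G] with y hy
  rw [chartConj, symm_chartOne, one_mul, inv_one, mul_one, PartialEquiv.right_inv _ hy]

theorem mfderiv_eq_fderiv_chart {f : G → G} (h1 : f 1 = 1)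
    (hf : MDifferentiableAt 𝓘(ℝ, E) 𝓘(ℝ, E) f 1) (v : E) :
    (mfderiv 𝓘(ℝ, E) 𝓘(ℝ, E) f 1 : E → E) v =
      fderiv ℝ (fun y : E ↦ extChartAt 𝓘(ℝ, E) (1 : G)
        (f ((extChartAt 𝓘(ℝ, E) (1 : G)).symm y))) (chartOne G) v := by
  have h : ∀ T : E →L[ℝ] E, T = fderivWithin ℝ (writtenInExtChartAt 𝓘(ℝ, E) 𝓘(ℝ, E) 1 f)
      (Set.range 𝓘(ℝ, E)) (extChartAt 𝓘(ℝ, E) (1 : G) 1) →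
      T = fderiv ℝ (fun y : E ↦ extChartAt 𝓘(ℝ, E) (1 : G)
        (f ((extChartAt 𝓘(ℝ, E) (1 : G)).symm y))) (chartOne G) := by
    rintro _ rfl
    rw [ModelWithCorners.range_eq_univ, fderivWithin_univ, writtenInExtChartAt, h1]
    rfl
  exact congrArg (fun T : E →L[ℝ] E ↦ T v) (h _ hf.mfderiv)

theorem hasFDerivAt_chartConj_right {a : E}
    (h : DifferentiableAt ℝ (chartConj G) ((a, chartOne G) : E × E)) :
    HasFDerivAt (fun y : E ↦ chartConj G (a, y))
      ((fderiv ℝ (chartConj G) (a, chartOne G)).comp (ContinuousLinearMap.inr ℝ E E))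
      (chartOne G) :=
  HasFDerivAt.comp (g := chartConj G) _ h.hasFDerivAt (hasFDerivAt_prodMk_right _ _)

variable [LieGroup 𝓘(ℝ, E) ∞ G]

theorem contMDiffAt_symm_conj :
    ContMDiffAt (𝓘(ℝ, E).prod 𝓘(ℝ, E)) 𝓘(ℝ, E) ∞
      (fun p : E × E ↦ (extChartAt 𝓘(ℝ, E) (1 : G)).symm p.1 *
        (extChartAt 𝓘(ℝ, E) (1 : G)).symm p.2 * ((extChartAt 𝓘(ℝ, E) (1 : G)).symm p.1)⁻¹)
      (chartOne G, chartOne G) := by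
  have h1 : ContMDiffAt (𝓘(ℝ, E).prod 𝓘(ℝ, E)) 𝓘(ℝ, E) ∞
      (fun p : E × E ↦ (extChartAt 𝓘(ℝ, E) (1 : G)).symm p.1) (chartOne G, chartOne G) :=
    (contMDiffAt_symm_chartOne G).comp (chartOne G, chartOne G) contMDiffAt_fst
  have h2 : ContMDiffAt (𝓘(ℝ, E).prod 𝓘(ℝ, E)) 𝓘(ℝ, E) ∞
      (fun p : E × E ↦ (extChartAt 𝓘(ℝ, E) (1 : G)).symm p.2) (chartOne G, chartOne G) :=
    (contMDiffAt_symm_chartOne G).comp (chartOne G, chartOne G) contMDiffAt_snd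
  exact (h1.mul h2).mul h1.inv

theorem contDiffAt_chartConj : ContDiffAt ℝ ∞ (chartConj G) ((chartOne G, chartOne G) : E × E) := by
  have h4 : ContMDiffAt 𝓘(ℝ, E) 𝓘(ℝ, E) ∞ (extChartAt 𝓘(ℝ, E) (1 : G))
      ((extChartAt 𝓘(ℝ, E) (1 : G)).symm (chartOne G) *
        (extChartAt 𝓘(ℝ, E) (1 : G)).symm (chartOne G) *
        ((extChartAt 𝓘(ℝ, E) (1 : G)).symm (chartOne G))⁻¹) := by
    rw [symm_chartOne, mul_one, mul_inv_cancel]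
    exact contMDiffAt_extChartAt
  have h5 : ContMDiffAt (𝓘(ℝ, E).prod 𝓘(ℝ, E)) 𝓘(ℝ, E) ∞ (chartConj G)
      ((chartOne G, chartOne G) : E × E) :=
    ContMDiffAt.comp (I' := 𝓘(ℝ, E)) (chartOne G, chartOne G) h4 (contMDiffAt_symm_conj G)
  rwa [← modelWithCornersSelf_prod, chartedSpaceSelf_prod, contMDiffAt_iff_contDiffAt] at h5

theorem eventually_differentiableAt_chartConj :
    ∀ᶠ p in 𝓝 ((chartOne G, chartOne G) : E × E), DifferentiableAt ℝ (chartConj G) p := by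
  filter_upwards [((contDiffAt_chartConj G).of_le (m := 1) (by norm_cast)).eventually (by simp)]
    with p hp
  exact hp.differentiableAt (by simp)

theorem Ad_symm_apply (x : GroupLieAlgebra 𝓘(ℝ, E) G) :
    ∀ᶠ a in 𝓝 (chartOne G : E),
      Ad ((extChartAt 𝓘(ℝ, E) (1 : G)).symm a) x = chartAd (E := E) G x a := by
  filter_upwards [tendsto_prodMk_chartOne.eventually (eventually_differentiableAt_chartConj G)]
    with a ha
  have hd : ∀ g : G, MDifferentiableAt 𝓘(ℝ, E) 𝓘(ℝ, E) (fun b : G ↦ g * b * g⁻¹) 1 := fun g ↦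
    ((contMDiff_const.mul contMDiff_id).mul contMDiff_const :
      ContMDiff 𝓘(ℝ, E) 𝓘(ℝ, E) ∞ (fun b : G ↦ g * b * g⁻¹)).mdifferentiableAt (by simp)
  refine (mfderiv_eq_fderiv_chart (E := E) G (by simp) (hd _) x).trans ?_
  exact congrArg (fun T : E →L[ℝ] E ↦ T x) (hasFDerivAt_chartConj_right G ha).fderiv

theorem chartAd_chartOne (x : E) : chartAd G x (chartOne G) = x := by
  have h1 := hasFDerivAt_chartConj_right G
    (eventually_differentiableAt_chartConj (E := E) G).self_of_nhds
  have h2 : HasFDerivAt (fun y : E ↦ chartConj G (chartOne G, y)) (ContinuousLinearMap.id ℝ E)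
    (chartOne G) := (hasFDerivAt_id _).congr_of_eventuallyEq (chartConj_one_left G)
  exact congrArg (fun T : E →L[ℝ] E ↦ T x) (h1.unique h2)

theorem differentiableAt_chartAd (x : E) : DifferentiableAt ℝ (chartAd G x) (chartOne G) := by
  have h1 : DifferentiableAt ℝ (fderiv ℝ (chartConj G)) ((chartOne G, chartOne G) : E × E) :=
    ((contDiffAt_chartConj G).fderiv_right (m := 1) (by norm_cast)).differentiableAt (by simp)
  have h2 : DifferentiableAt ℝ (fun y : E ↦ ((y, chartOne G) : E × E)) (chartOne G) := by fun_prop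
  exact (DifferentiableAt.comp (g := fderiv ℝ (chartConj G))
    (f := fun y : E ↦ ((y, chartOne G) : E × E)) (chartOne G) h1 h2).clm_apply
    (differentiableAt_const _)

/-- Writing conjugation as `(a y a⁻¹) a = a y` allows it to be differentiated without
differentiating the inversion. -/
theorem chartMul_chartConj : ∀ᶠ p in 𝓝 ((chartOne G, chartOne G) : E × E),
    chartMul G (chartConj G p, p.1) = chartMul G p := by
  have hG : (extChartAt 𝓘(ℝ, E) (1 : G)).source ∈ 𝓝 (1 : G) := extChartAt_source_mem_nhds _
  filter_upwards [(contMDiffAt_symm_conj (E := E) G).continuousAt.preimage_mem_nhds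
    (by simpa only [symm_chartOne, mul_one, inv_one] using hG)] with p hp
  simp only [chartConj, chartMul]
  rw [PartialEquiv.left_inv _ hp, inv_mul_cancel_right]

theorem fderiv_chartMul_chartAd (x : E) : ∀ᶠ a in 𝓝 (chartOne G : E),
    fderiv ℝ (chartMul G) (chartOne G, a) (chartAd G x a, 0) = chartField G x a := by
  have hs : Tendsto (fun a : E ↦ ((chartOne G : E), a)) (𝓝 (chartOne G))
      (𝓝 (chartOne G, chartOne G)) := ContinuousAt.tendsto (by fun_prop)
  filter_upwards [tendsto_prodMk_chartOne.eventually (eventually_differentiableAt_chartConj G),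
    tendsto_prodMk_chartOne.eventually (eventually_differentiableAt_chartMul G),
    hs.eventually (eventually_differentiableAt_chartMul G),
    tendsto_prodMk_chartOne.eventually (chartMul_chartConj (E := E) G).eventually_nhds]
    with a hca hma hma' heq
  have h1 : HasFDerivAt (fun y : E ↦ chartMul G ((a, y) : E × E))
      ((fderiv ℝ (chartMul G) (a, chartOne G)).comp (ContinuousLinearMap.inr ℝ E E))
      (chartOne G) :=
    HasFDerivAt.comp (g := chartMul G) _ hma.hasFDerivAt (hasFDerivAt_prodMk_right _ _)
  have h2 : HasFDerivAt (fun y : E ↦ ((chartConj G (a, y), a) : E × E))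
      ((ContinuousLinearMap.inl ℝ E E).comp ((fderiv ℝ (chartConj G) (a, chartOne G)).comp
        (ContinuousLinearMap.inr ℝ E E))) (chartOne G) :=
    HasFDerivAt.comp (g := fun y : E ↦ ((y, a) : E × E)) _ (hasFDerivAt_prodMk_left _ _)
      (hasFDerivAt_chartConj_right G hca)
  have h3 : HasFDerivAt (fun y : E ↦ chartMul G ((chartConj G (a, y), a) : E × E))
      ((fderiv ℝ (chartMul G) (chartOne G, a)).comp
        ((ContinuousLinearMap.inl ℝ E E).comp ((fderiv ℝ (chartConj G) (a, chartOne G)).comp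
        (ContinuousLinearMap.inr ℝ E E)))) (chartOne G) := by
    refine HasFDerivAt.comp (g := chartMul G) _ ?_ h2
    rw [chartConj_chartOne]
    exact hma'.hasFDerivAt
  have h4 : (fun y : E ↦ chartMul G ((chartConj G (a, y), a) : E × E)) =ᶠ[𝓝 (chartOne G)]
      fun y ↦ chartMul G ((a, y) : E × E) :=
    Tendsto.eventually (f := fun y : E ↦ ((a, y) : E × E)) (ContinuousAt.tendsto (by fun_prop)) heq
  exact congrArg (fun T : E →L[ℝ] E ↦ T x) (h3.unique (h1.congr_of_eventuallyEq h4))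

theorem fderiv_chartMul_inl (u : E) :
    fderiv ℝ (chartMul G) ((chartOne G, chartOne G) : E × E) (u, 0) = u := by
  have h1 : HasFDerivAt (fun y : E ↦ chartMul G ((y, chartOne G) : E × E))
      ((fderiv ℝ (chartMul G) (chartOne G, chartOne G)).comp (ContinuousLinearMap.inl ℝ E E))
      (chartOne G) :=
    HasFDerivAt.comp (g := chartMul G) _
      (eventually_differentiableAt_chartMul (E := E) G).self_of_nhds.hasFDerivAt
      (hasFDerivAt_prodMk_left _ _)
  have h2 : HasFDerivAt (fun y : E ↦ chartMul G ((y, chartOne G) : E × E))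
      (ContinuousLinearMap.id ℝ E) (chartOne G) :=
    (hasFDerivAt_id _).congr_of_eventuallyEq (chartMul_one_right G)
  exact congrArg (fun T : E →L[ℝ] E ↦ T u) (h1.unique h2)

/-- Differentiating `fderiv_chartMul_chartAd` in `a` at the unit yields the derivative of `Ad` plus
a mixed second derivative of `chartMul`; symmetry of second derivatives identifies the latter with
the derivative of `chartField G z`. -/
theorem fderiv_chartAd (x z : E) : fderiv ℝ (chartAd G x) (chartOne G) z =
    fderiv ℝ (chartField G x) (chartOne G) z - fderiv ℝ (chartField G z) (chartOne G) x := by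
  have h1 := HasFDerivAt.comp (g := fderiv ℝ (chartMul G))
    (f := fun y : E ↦ ((chartOne G, y) : E × E)) (chartOne G)
    (differentiableAt_fderiv_chartMul (E := E) G).hasFDerivAt (hasFDerivAt_prodMk_right _ _)
  have h2 : HasFDerivAt (fun a : E ↦ ((chartAd G x a, 0) : E × E))
      ((ContinuousLinearMap.inl ℝ E E).comp (fderiv ℝ (chartAd G x) (chartOne G))) (chartOne G) :=
    HasFDerivAt.comp (g := fun y : E ↦ ((y, 0) : E × E)) _ (hasFDerivAt_prodMk_left _ _)
      (differentiableAt_chartAd G x).hasFDerivAt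
  have h3 := (h1.clm_apply h2).unique
    ((hasFDerivAt_chartField G x).congr_of_eventuallyEq (fderiv_chartMul_chartAd G x))
  have h4 := congrArg (fun T : E →L[ℝ] E ↦ T z) h3
  have hsymm := (contDiffAt_chartMul (E := E) G).isSymmSndFDerivAt
    (by rw [minSmoothness_of_isRCLikeNormedField]; norm_cast)
  rw [(hasFDerivAt_chartField G x).fderiv, (hasFDerivAt_chartField G z).fderiv]
  simp only [Function.comp_apply, add_apply, ContinuousLinearMap.comp_apply,
    ContinuousLinearMap.inl_apply, ContinuousLinearMap.inr_apply, ContinuousLinearMap.flip_apply,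
    fderiv_chartMul_inl, chartAd_chartOne] at h4 ⊢
  rw [hsymm.eq (x, 0) (0, z), ← h4, add_sub_cancel_right]

end ChartConj

/-! ### Infinitesimal invariance of `Q`, and the theorem. -/

theorem IsBiinvariant.isAdInvariant {E : Type*} [NormedAddCommGroup E] [NormedSpace ℝ E]
    [FiniteDimensional ℝ E] {G : Type*} [TopologicalSpace G] [ChartedSpace E G] [Group G]
    [LieGroup 𝓘(ℝ, E) ∞ G] {Q : LinearMap.BilinForm ℝ (GroupLieAlgebra 𝓘(ℝ, E) G)}
    (hQ : IsBiinvariant Q) : IsAdInvariant Q := by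
  have hE : CompleteSpace E := FiniteDimensional.complete ℝ E
  have had (x z : GroupLieAlgebra 𝓘(ℝ, E) G) :
      fderiv ℝ (chartAd (E := E) G x) (chartOne G) z = ⁅z, x⁆ :=
    (fderiv_chartAd (E := E) G x z).trans (bracket_eq_fderiv_fderiv_chartMul G z x).symm
  let B : E →L[ℝ] E →L[ℝ] ℝ := LinearMap.toContinuousBilinearMap (E := E) (F := E) Q
  intro x z y
  have h1 := B.hasFDerivAt_of_bilinear (differentiableAt_chartAd (E := E) G x).hasFDerivAt
    (differentiableAt_chartAd (E := E) G y).hasFDerivAt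
  -- Invariance under `Ad a` for `a` near `1` makes this function constant; its derivative at `1` is
  -- the invariance under `ad`.
  have h2 : (fun a : E ↦ B (chartAd G x a) (chartAd G y a)) =ᶠ[nhds (chartOne G)]
      fun _ ↦ Q x y := by
    filter_upwards [Ad_symm_apply G x, Ad_symm_apply G y] with a hx hy
    refine Eq.trans ?_ (hQ ((extChartAt 𝓘(ℝ, E) (1 : G)).symm a) x y)
    rw [hx, hy]
    rfl
  have h3 := h1.unique ((hasFDerivAt_const (Q x y) (chartOne G : E)).congr_of_eventuallyEq h2)
  have h4 : B (chartAd (E := E) G x (chartOne G)) (fderiv ℝ (chartAd (E := E) G y) (chartOne G) z) +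
      B (fderiv ℝ (chartAd (E := E) G x) (chartOne G) z) (chartAd (E := E) G y (chartOne G)) = 0 :=
    congrArg (fun T : E →L[ℝ] ℝ ↦ T z) h3
  have h5 : Q x ⁅z, y⁆ + Q ⁅z, x⁆ y = 0 := by
    rw [← had y z, ← had x z]
    refine Eq.trans ?_ h4
    refine congrArg₂ (· + ·) (congrArg₂ (fun a b ↦ B a b) ?_ rfl)
      (congrArg₂ (fun a b ↦ B a b) rfl ?_)
    · exact (chartAd_chartOne (E := E) G x).symm
    · exact (chartAd_chartOne (E := E) G y).symm
  rw [← lie_skew, map_neg, LinearMap.neg_apply]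
  linarith

theorem theorem1p1
    {EG : Type*} [NormedAddCommGroup EG] [NormedSpace ℝ EG] [FiniteDimensional ℝ EG]
    {G : Type*} [TopologicalSpace G] [ChartedSpace EG G] [Group G] [LieGroup 𝓘(ℝ, EG) ∞ G]
    [CompactSpace G]
    {EH : Type*} [NormedAddCommGroup EH] [NormedSpace ℝ EH] [FiniteDimensional ℝ EH]
    (H : Subgroup G) [ChartedSpace EH H] [LieGroup 𝓘(ℝ, EH) ∞ H] [CompactSpace H]
    (hH : ContMDiff 𝓘(ℝ, EH) 𝓘(ℝ, EG) ∞ (Subtype.val : H → G))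
    (Q : LinearMap.BilinForm ℝ (GroupLieAlgebra 𝓘(ℝ, EG) G))
    (hQ : IsInnerProduct Q) (hQinv : IsBiinvariant Q)
    (hcurv : ∃ (t : ℝ) (ht : 1 < t),
      HasNonnegSectionalCurvature (stretchedMetric (EH := EH) H Q hQ t (zero_lt_one.trans ht))) :
    ∃ J : LieIdeal ℝ (GroupLieAlgebra 𝓘(ℝ, EG) G),
      J.toSubmodule =
        (semisimplePart (GroupLieAlgebra 𝓘(ℝ, EH) H)).toSubmodule.map (lieAlgebraInclusion H) := by
  obtain ⟨t, ht, hK⟩ := hcurv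
  have hcG : CompleteSpace EG := FiniteDimensional.complete ℝ EG
  have hcH : CompleteSpace EH := FiniteDimensional.complete ℝ EH
  let ι : GroupLieAlgebra 𝓘(ℝ, EH) H →ₗ⁅ℝ⁆ GroupLieAlgebra 𝓘(ℝ, EG) G :=
    { lieAlgebraInclusion H with map_lie' := lieAlgebraInclusion_lie H hH _ _ }
  have hQ' := hQinv.isAdInvariant
  obtain ⟨n, hn, hcurv⟩ := curvature_nonneg_of_hasNonnegSectionalCurvature _ hK
  exact exists_lieIdeal_eq_map_semisimplePart hQ hQ' ι fun x y hxy ↦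
    lie_orthProj_eq_zero_of_curvature_nonneg hQ hQ' ι.range ht hn hcurv hxy
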